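/- **Setting.** Let $U\subseteq\mathbb R^d$ be open (the domain of $f$; e.g. $U=\mathbb R^d$) and let $f:U\to\mathbb R$ be differentiable and bounded below. Assume that $f$ is $(L_0,L_\rho)$-smooth with $0\le\rho<2$ and $L_0,L_\rho\ge 0$, i.e. $f$ is twice differentiable on $U$ and $\|\nabla^2 f(x)\|\le L_0+L_\rho\|\nabla f(x)\|^{\rho}$ for almost every $x\in U$ (spectral and Euclidean norms). Adam with parameters $\beta,\beta_{\rm sq},\eta,\lambda>0$ started at $x_1\in U$ is the iteration ($m_0=v_0=0$; squares, square roots, quotients and $\odot$ are coordinate-wise), for $t=1,\dots,T$, $$m_t=(1-\beta)m_{t-1}+\beta g_t,\quad v_t=(1-\beta_{\rm sq})v_{t-1}+\beta_{\rm sq}g_t^2,\quad \hat m_t=\frac{m_t}{1-(1-\beta)^t},\quad \hat v_t=\frac{v_t}{1-(1-\beta_{\rm sq})^t},\quad x_{t+1}=x_t-\frac{\eta}{\sqrt{\hat v_t}+\lambda}\odot\hat m_t ,$$ where $g_t=\nabla f(x_t,\xi_t)$ is the stochastic gradient for the random sample $\xi_t$. Assume that for $1\le t\le T$ one has $\mathbb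 E[g_t-\nabla f(x_t)\mid\xi_1,\dots,\xi_{t-1}]=0$ and $\|g_t-\nabla f(x_t)\|\le\sigma$ almost surely, and that almost surely the iteration runs inside $U$, i.e. the segments $[x_t,x_{t+1}]$, $1\le t\le T$, lie in $U$ (no condition if $U=\mathbb R^d$). Put $\Delta_1=f(x_1)-\inf_U f$ and, for $G>0$, $$r=\min\Big\{\frac1{5L_\rho G^{\rho-1}},\frac1{5(L_0^{\rho-1}L_\rho)^{1/\rho}}\Big\},\qquad L=3L_0+4L_\rho G^\rho ,$$ where here and below $a/0=+\infty$ for $a>0$, and the second entry of $r$ is omitted if $\rho=0$ or $L_0=0$. **Theorem.** For all sufficiently large numerical constants $C_1,C_2$ and all $c_1,c_2>0$ that are sufficiently small (depending only on $C_1,C_2$) the following holds. Let $0<\delta<1$, $\iota=\max\{1,\log(1/\delta)\}$, $\epsilon>0$, $\lambda>0$, let $$G\ge\max\Big\{2\lambda,\,2\sigma,\,2\|\nabla f(x_1)\|,\,\sqrt{C_1\Delta_1L_0\sqrt d},\,(C_1\Delta_1L_\rho\sqrt d)^{\frac1{2-\rho}}\Big\},$$ and choose $\beta,\eta>0$ and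 $T$ with $$\beta_{\rm sq}=\beta\le\min\Big\{1,\frac{c_1\lambda\epsilon^2}{\sigma^2G\sqrt\iota}\Big\},\quad \eta\le c_2\min\Big\{\frac r{\sqrt d},\frac{\lambda\beta}{\sqrt{d\iota}\,L},\frac{\lambda^{3/2}\beta}{L\sqrt G}\Big\},\quad T=\Big\lceil\max\Big\{\frac1{\beta^2},\frac{C_2\Delta_1G}{\eta\epsilon^2}\Big\}\Big\rceil .$$ Then with probability at least $1-\delta$ one has $\|\nabla f(x_t)\|\le G$ for all $1\le t\le T$ and $$\frac1T\sum_{t=1}^T\|\nabla f(x_t)\|^2\le\epsilon^2 .$$ Moreover the gradient complexity is $O\big(d^{\,p}\epsilon^{-4}\big)$ with $p=\max\{\frac2{2-\rho},\frac{5+2\rho}{4(2-\rho)}\}$: given $\rho,L_0,L_\rho,\lambda,\sigma,\delta,\Delta_1,\|\nabla f(x_1)\|$ (and $c_1,c_2,C_1,C_2$) there is a constant $K$ such that for all $d\ge1$ and $0<\epsilon\le1$ there are $G,\beta,\eta$ as above for which $T\le K d^{\,p}\epsilon^{-4}$. -/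

import Mathlib

open MeasureTheory
open scoped ENNReal

universe u v

noncomputable section

/-- `ℝᵈ` with the Euclidean norm. -/
abbrev RVec (d : ℕ) : Type := EuclideanSpace ℝ (Fin d)

/-! ### The Adam algorithm -/

/-- The variables of Adam at the end of iteration `t` (iteration `0` is the initialization):
the momenta `m_t`, `v_t` and the point `x_{t+1}`. -/
structure AdamState (d : ℕ) where
  m : RVec d
  v : RVec d
  x : RVec d

/-- Iteration `t ≥ 1` of Adam with stochastic gradient oracle `g x z = ∇f(x, z)` and sample `z`:
momentum updates, bias corrections and the coordinate-wise step. -/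
def adamStep {d : ℕ} {Ξ : Type v} (g : RVec d → Ξ → RVec d) (β β₂ η lam : ℝ)
    (t : ℕ) (z : Ξ) (s : AdamState d) : AdamState d :=
  let m : RVec d := WithLp.toLp 2 fun i => (1 - β) * s.m i + β * g s.x z i
  let v : RVec d := WithLp.toLp 2 fun i => (1 - β₂) * s.v i + β₂ * (g s.x z i) ^ 2
  let mhat : RVec d := WithLp.toLp 2 fun i => m i / (1 - (1 - β) ^ t)
  let vhat : RVec d := WithLp.toLp 2 fun i => v i / (1 - (1 - β₂) ^ t)
  { m := m
    v := v
    x := WithLp.toLp 2 fun i => s.x i - η / (Real.sqrt (vhat i) + lam) * mhat i }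

/-- The state after `t` iterations, when iteration `s` uses the sample `z s` (`s = 1, 2, …`). -/
def adamState {d : ℕ} {Ξ : Type v} (g : RVec d → Ξ → RVec d) (β β₂ η lam : ℝ)
    (xinit : RVec d) (z : ℕ → Ξ) : ℕ → AdamState d
  | 0 => { m := 0, v := 0, x := xinit }
  | t + 1 => adamStep g β β₂ η lam (t + 1) (z (t + 1)) (adamState g β β₂ η lam xinit z t)

/-- The iterate `x_t`, `t ≥ 1`; in particular `x_1 = xinit`. -/
def adamIter {d : ℕ} {Ξ : Type v} (g : RVec d → Ξ → RVec d) (β β₂ η lam : ℝ)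
    (xinit : RVec d) (z : ℕ → Ξ) (t : ℕ) : RVec d :=
  (adamState g β β₂ η lam xinit z (t - 1)).x

/-! ### The function class -/

/-- `f` is twice differentiable on the open set `U`, and its Hessian (the derivative of the
gradient, with the operator norm) satisfies `‖∇²f(x)‖ ≤ L₀ + L_ρ ‖∇f(x)‖ ^ ρ` for almost
every `x ∈ U`. -/
def IsL0LrhoSmooth {d : ℕ} (U : Set (RVec d)) (f : RVec d → ℝ) (ρ L₀ Lρ : ℝ) : Prop :=
  (∀ x ∈ U, DifferentiableAt ℝ (gradient f) x) ∧
    ∀ᵐ x ∂(volume : Measure (RVec d)), x ∈ U →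
      ‖fderiv ℝ (gradient f) x‖ ≤ L₀ + Lρ * ‖gradient f x‖ ^ ρ

/-! ### The noise -/

/-- The σ-algebra generated by `ξ_1, …, ξ_{t-1}`. -/
abbrev samplesBefore {Ω : Type u} {Ξ : Type v} [MeasurableSpace Ξ] (ξ : ℕ → Ω → Ξ) (t : ℕ) :
    MeasurableSpace Ω :=
  ⨆ (s : ℕ) (_ : 1 ≤ s ∧ s < t), MeasurableSpace.comap (ξ s) inferInstance

/-- The noise of the stochastic gradients `g (x t) (ξ t)`, `1 ≤ t ≤ T`, is conditionally centered
given the earlier samples and almost surely bounded by `σ`. (The centering is written for the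
noise, which is bounded and hence integrable.) -/
def CenteredBoundedNoise {d : ℕ} {Ω : Type u} {Ξ : Type v} [MeasurableSpace Ω]
    [MeasurableSpace Ξ] (μ : Measure Ω) (f : RVec d → ℝ) (g : RVec d → Ξ → RVec d)
    (ξ : ℕ → Ω → Ξ) (x : ℕ → Ω → RVec d) (σ : ℝ) (T : ℕ) : Prop :=
  ∀ t : ℕ, 1 ≤ t → t ≤ T →
    (μ[fun ω => g (x t ω) (ξ t ω) - gradient f (x t ω) | samplesBefore ξ t] =ᵐ[μ] 0) ∧
    ∀ᵐ ω ∂μ, ‖g (x t ω) (ξ t ω) - gradient f (x t ω)‖ ≤ σ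

/-! ### Parameters -/

/-- `log (1/δ)`, but at least `1`. -/
def logFactor (δ : ℝ) : ℝ := max 1 (Real.log (1 / δ))

/-- The quotient `a / b` of nonnegative reals, equal to `∞` when `b = 0 < a`. -/
def extDiv (a b : ℝ) : ℝ≥0∞ := ENNReal.ofReal a / ENNReal.ofReal b

/-- `r = min {1 / (5 L_ρ G^(ρ-1)), 1 / (5 (L₀^(ρ-1) L_ρ)^(1/ρ))}`, where `1/0 = ∞` and the second
entry is left out when `ρ = 0` or `L₀ = 0`. -/
def localRadius (ρ L₀ Lρ G : ℝ) : ℝ≥0∞ :=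
  min (extDiv 1 (5 * Lρ * G ^ (ρ - 1)))
    (if ρ = 0 ∨ L₀ = 0 then ⊤ else extDiv 1 (5 * (L₀ ^ (ρ - 1) * Lρ) ^ (1 / ρ)))

/-- `L = 3 L₀ + 4 L_ρ G^ρ`. -/
def effSmooth (ρ L₀ Lρ G : ℝ) : ℝ := 3 * L₀ + 4 * Lρ * G ^ ρ

/-- The choice of `G`, `β`, `η` for dimension `d`, problem constants `ρ, L₀, L_ρ, σ`,
regularization `lam`, logarithmic factor `ι`, initial gap `Δ₁`, initial gradient norm `n₁`,
accuracy `ε` and numerical constants `c₁, c₂, C₁`. -/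
structure AdamChoice (d : ℕ) (ρ L₀ Lρ lam σ ι Δ₁ n₁ ε c₁ c₂ C₁ G β η : ℝ) : Prop where
  G_pos : 0 < G
  G_ge_lam : 2 * lam ≤ G
  G_ge_sigma : 2 * σ ≤ G
  G_ge_grad : 2 * n₁ ≤ G
  G_ge_L0 : Real.sqrt (C₁ * Δ₁ * L₀ * Real.sqrt d) ≤ G
  G_ge_Lrho : (C₁ * Δ₁ * Lρ * Real.sqrt d) ^ (1 / (2 - ρ)) ≤ G
  beta_pos : 0 < β
  beta_le : ENNReal.ofReal β ≤ min 1 (extDiv (c₁ * lam * ε ^ 2) (σ ^ 2 * G * Real.sqrt ι))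
  eta_pos : 0 < η
  eta_le : ENNReal.ofReal η ≤ ENNReal.ofReal c₂ *
    min (localRadius ρ L₀ Lρ G / ENNReal.ofReal (Real.sqrt d))
      (min (extDiv (lam * β) (Real.sqrt (d * ι) * effSmooth ρ L₀ Lρ G))
        (extDiv (lam ^ (3 / 2 : ℝ) * β) (effSmooth ρ L₀ Lρ G * Real.sqrt G)))

/-- The number of iterations `T = max {1/β², C₂ Δ₁ G / (η ε²)}`, rounded up to an integer. -/
def adamHorizon (Δ₁ ε C₂ G β η : ℝ) : ℕ :=
  ⌈max (1 / β ^ 2) (C₂ * Δ₁ * G / (η * ε ^ 2))⌉₊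

/-- The initial sub-optimality gap `f(x₁) - inf_U f`. -/
def initialGap {d : ℕ} (U : Set (RVec d)) (f : RVec d → ℝ) (x₁ : RVec d) : ℝ :=
  f x₁ - sInf (f '' U)

end

/-!
While the gradient stays below `G`, a step of Adam is short enough for `f` to be `L`-smooth along it
in the ordinary sense, and the denominator of Adam lies between `λ` and a multiple of `G`. Descent
then bounds `∑ ‖∇f(x_t)‖²` by the initial gap and the accumulated error of the momentum. That
error splits into a lag behind the gradient, which the small step size absorbs into the left-hand
side, and the averaged noise, which Azuma–Hoeffding controls with high probability. Finally the
gradient can only grow from `G/2` to `G` by short steps that each contribute at least `G²/4` to the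
sum, so the bound on the sum keeps the gradient below `G`, and the two bounds follow by induction on
the time.
-/

/-! ### Mean value inequalities under almost everywhere derivative bounds -/

section MeanValue

open Set Filter Topology

theorem norm_sub_le_of_ae_norm_deriv_le {F : Type*} [NormedAddCommGroup F] [NormedSpace ℝ F]
    [CompleteSpace F] {φ : ℝ → F} {a b M : ℝ} (hab : a ≤ b)
    (hφ : ∀ s ∈ Icc a b, DifferentiableAt ℝ φ s) (hM : ∀ᵐ s, s ∈ Icc a b → ‖deriv φ s‖ ≤ M) :
    ‖φ b - φ a‖ ≤ M * (b - a) := by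
  have hderiv : ∀ s ∈ uIcc a b, HasDerivAt φ (deriv φ s) s := fun s hs =>
    (hφ s (by rwa [uIcc_of_le hab] at hs)).hasDerivAt
  have hint : IntervalIntegrable (deriv φ) volume a b := by
    rw [intervalIntegrable_iff_integrableOn_Icc_of_le hab]
    exact Measure.integrableOn_of_bounded (by simp) (aestronglyMeasurable_deriv φ volume)
      ((ae_restrict_iff' measurableSet_Icc).2 hM)
  rw [← intervalIntegral.integral_eq_sub_of_hasDerivAt hderiv hint,
    ← abs_of_nonneg (sub_nonneg.2 hab)]
  refine intervalIntegral.norm_integral_le_of_norm_le_const_ae ?_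
  filter_upwards [hM] with s hs hsab
  rw [uIoc_of_le hab] at hsab
  exact hs (Ioc_subset_Icc_self hsab)

variable {E F : Type*} [NormedAddCommGroup E] [NormedSpace ℝ E] [NormedAddCommGroup F]
  [NormedSpace ℝ F]

theorem eventually_forall_add_smul_mem {W : Set E} {x v : E} (hW : IsOpen W)
    (hx : ∀ s ∈ Icc (0 : ℝ) 1, x + s • v ∈ W) :
    ∀ᶠ z in 𝓝 x, ∀ s ∈ Icc (0 : ℝ) 1, z + s • v ∈ W := by
  refine isCompact_Icc.eventually_forall_of_forall_eventually fun s hs => ?_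
  have hcont : ContinuousAt (fun p : E × ℝ => p.1 + p.2 • v) (x, s) := by fun_prop
  exact hcont (hW.mem_nhds (hx s hs))

variable [FiniteDimensional ℝ E] [MeasurableSpace E] [BorelSpace E] {μ : Measure E}
  [μ.IsAddHaarMeasure] [CompleteSpace F]

theorem frequently_ae_add_smul {p : E → Prop} (hp : ∀ᵐ x ∂μ, p x) (x v : E) :
    ∃ᶠ z in 𝓝 x, ∀ᵐ s : ℝ, p (z + s • v) := by
  obtain ⟨S, hS, hSmeas, hSp⟩ := hp.exists_measurable_mem
  have hlines : ∀ᵐ z ∂μ, ∀ᵐ s : ℝ, z + s • v ∈ S :=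
    (ae_ae_add_linearMap_mem_iff (LinearMap.toSpanSingleton ℝ E v) volume μ hSmeas).2 hS
  exact (mem_closure_iff_frequently.1 (Measure.dense_of_ae hlines x)).mono
    fun z hz => Eventually.mono (mem_ofPred.1 hz) fun s hs => hSp _ hs

/-- The given line may miss the set of full measure, but almost every parallel line does not; the
bound passes to the limit of such lines. -/
theorem norm_add_sub_le_of_ae_norm_fderiv_le {Φ : E → F} {W : Set E} {M : ℝ} (hW : IsOpen W)
    (hΦ : ∀ x ∈ W, DifferentiableAt ℝ Φ x) (hM : ∀ᵐ x ∂μ, x ∈ W → ‖fderiv ℝ Φ x‖ ≤ M)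
    {x v : E} (hxv : ∀ s ∈ Icc (0 : ℝ) 1, x + s • v ∈ W) : ‖Φ (x + v) - Φ x‖ ≤ M * ‖v‖ := by
  have hx : x ∈ W := by simpa using hxv 0 (by simp)
  have hy : x + v ∈ W := by simpa using hxv 1 (by simp)
  have hlim : Tendsto (fun z => ‖Φ (z + v) - Φ z‖) (𝓝 x) (𝓝 ‖Φ (x + v) - Φ x‖) := by
    have htranslate : ContinuousAt (fun z => Φ (z + v)) x :=
      ContinuousAt.comp (f := fun z => z + v) (hΦ _ hy).continuousAt (by fun_prop)
    exact (htranslate.sub (hΦ _ hx).continuousAt).norm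
  refine le_of_tendsto_of_frequently hlim (((frequently_ae_add_smul hM x v).and_eventually
    (eventually_forall_add_smul_mem hW hxv)).mono ?_)
  rintro z ⟨hbound, hzv⟩
  have hderiv : ∀ s ∈ Icc (0 : ℝ) 1, HasDerivAt (fun s : ℝ => Φ (z + s • v))
      (fderiv ℝ Φ (z + s • v) v) s := fun s hs => by
    have hline : HasDerivAt (fun s : ℝ => z + s • v) v s := by
      simpa using ((hasDerivAt_id s).smul_const v).const_add z
    exact (hΦ _ (hzv s hs)).hasFDerivAt.comp_hasDerivAt s hline
  have hincr := norm_sub_le_of_ae_norm_deriv_le (φ := fun s : ℝ => Φ (z + s • v)) (M := M * ‖v‖)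
    zero_le_one (fun s hs => (hderiv s hs).differentiableAt) (by
      filter_upwards [hbound] with s hs hs01
      rw [(hderiv s hs01).deriv]
      exact ContinuousLinearMap.le_of_opNorm_le _ (hs (hzv s hs01)) v)
  simpa using hincr

theorem forall_lt_of_bootstrap {u : ℝ → ℝ} {a b c B : ℝ} (hu : ContinuousOn u (Icc a c))
    (ha : u a < B) (hb : b < B)
    (himp : ∀ s ∈ Icc a c, (∀ r ∈ Icc a s, u r < B) → u s ≤ b) : ∀ s ∈ Icc a c, u s < B := by
  obtain ⟨m, hbm, hmB⟩ := exists_between (max_lt ha hb)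
  by_contra! hcon
  obtain ⟨s₁, hs₁, hBs₁⟩ := hcon
  have hcompact : IsCompact (Icc a c ∩ u ⁻¹' Ici m) :=
    isCompact_Icc.of_isClosed_subset
      (hu.preimage_isClosed_of_isClosed isClosed_Icc isClosed_Ici) inter_subset_left
  obtain ⟨s₀, ⟨hs₀, hms₀⟩, hleast⟩ := hcompact.exists_isLeast ⟨s₁, hs₁, (hmB.trans_le hBs₁).le⟩
  have hsub : Icc a s₀ ⊆ Icc a c := Icc_subset_Icc_right hs₀.2
  obtain ⟨s, hs, hus⟩ := intermediate_value_Icc hs₀.1 (hu.mono hsub)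
    ⟨((le_max_left _ _).trans_lt hbm).le, hms₀⟩
  obtain rfl : s = s₀ := le_antisymm hs.2 (hleast ⟨hsub hs, hus.ge⟩)
  have hbelow : ∀ r ∈ Icc a s, u r < B := fun r hr => by
    by_contra! hBr
    obtain rfl : r = s := le_antisymm hr.2 (hleast ⟨hsub hr, (hmB.trans_le hBr).le⟩)
    linarith
  linarith [himp s hs₀ hbelow, le_max_right (u a) b]

variable {Φ : E → F} {U : Set E} {ℓ : ℝ → ℝ} {x v : E}

theorem norm_add_sub_le_of_norm_lt {B : ℝ} (hU : IsOpen U) (hΦ : ∀ x ∈ U, DifferentiableAt ℝ Φ x)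
    (hℓ : MonotoneOn ℓ (Ici 0)) (hℓΦ : ∀ᵐ x ∂μ, x ∈ U → ‖fderiv ℝ Φ x‖ ≤ ℓ ‖Φ x‖)
    (hxv : ∀ s ∈ Icc (0 : ℝ) 1, x + s • v ∈ U)
    (hB : ∀ s ∈ Icc (0 : ℝ) 1, ‖Φ (x + s • v)‖ < B) : ‖Φ (x + v) - Φ x‖ ≤ ℓ B * ‖v‖ := by
  have hcont : ContinuousOn (fun z => ‖Φ z‖) U := fun z hz =>
    (hΦ z hz).continuousAt.norm.continuousWithinAt
  refine norm_add_sub_le_of_ae_norm_fderiv_le (μ := μ)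
    (hcont.isOpen_inter_preimage hU isOpen_Iio) (fun z hz => hΦ z hz.1) ?_
    fun s hs => ⟨hxv s hs, hB s hs⟩
  filter_upwards [hℓΦ] with z hz ⟨hzU, hzB⟩
  have hzB : ‖Φ z‖ ≤ B := le_of_lt hzB
  exact (hz hzU).trans (hℓ (norm_nonneg _) ((norm_nonneg _).trans hzB) hzB)

/-- A step too short for `Φ` to gain `a` at rate `ℓ (G + a)` keeps `‖Φ‖` below `G + a`, so that the
rate `ℓ (G + a)` is valid along the whole step. -/
theorem norm_add_sub_le_of_short_step {G a : ℝ} (hU : IsOpen U)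
    (hΦ : ∀ x ∈ U, DifferentiableAt ℝ Φ x) (hℓ : MonotoneOn ℓ (Ici 0))
    (hℓΦ : ∀ᵐ x ∂μ, x ∈ U → ‖fderiv ℝ Φ x‖ ≤ ℓ ‖Φ x‖)
    (hxv : ∀ s ∈ Icc (0 : ℝ) 1, x + s • v ∈ U) (hx : ‖Φ x‖ ≤ G) (ha : 0 < a)
    (hshort : ℓ (G + a) * ‖v‖ < a) : ‖Φ (x + v) - Φ x‖ ≤ ℓ (G + a) * ‖v‖ := by
  refine norm_add_sub_le_of_norm_lt hU hΦ hℓ hℓΦ hxv <|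
    forall_lt_of_bootstrap (u := fun s : ℝ => ‖Φ (x + s • v)‖) (b := G + max 0 (ℓ (G + a) * ‖v‖))
      (fun s hs => ?_) ?_ ?_ fun s hs hlt => ?_
  · exact (ContinuousAt.comp (f := fun s : ℝ => x + s • v) (hΦ _ (hxv s hs)).continuousAt
      (by fun_prop)).norm.continuousWithinAt
  · simpa using by linarith
  · simpa using ⟨ha, hshort⟩
  · have hscaled : ∀ r ∈ Icc (0 : ℝ) 1, r * s ∈ Icc 0 s := fun r hr =>
      ⟨mul_nonneg hr.1 hs.1, mul_le_of_le_one_left hs.1 hr.2⟩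
    have hincr := norm_add_sub_le_of_norm_lt (x := x) (v := s • v) hU hΦ hℓ hℓΦ
      (fun r hr => by
        rw [smul_smul]
        exact hxv _ (Icc_subset_Icc_right hs.2 (hscaled r hr)))
      (fun r hr => by
        rw [smul_smul]
        exact hlt _ (hscaled r hr))
    rw [norm_smul, Real.norm_of_nonneg hs.1] at hincr
    have hmax : ℓ (G + a) * (s * ‖v‖) ≤ max 0 (ℓ (G + a) * ‖v‖) := by
      rw [mul_left_comm]
      exact (mul_le_mul_of_nonneg_left (le_max_right 0 _) hs.1).trans
        (mul_le_of_le_one_left (le_max_left _ _) hs.2)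
    linarith [norm_le_norm_add_norm_sub' (Φ (x + s • v)) (Φ x)]

end MeanValue

theorem sub_le_inner_gradient_add {E : Type*} [NormedAddCommGroup E] [InnerProductSpace ℝ E]
    [CompleteSpace E] {f : E → ℝ} {x y : E} {C : ℝ}
    (hf : ∀ z ∈ segment ℝ x y, DifferentiableAt ℝ f z)
    (hC : ∀ z ∈ segment ℝ x y, ‖gradient f z - gradient f x‖ ≤ C) :
    f y - f x ≤ inner ℝ (gradient f x) (y - x) + C * ‖y - x‖ := by
  obtain ⟨z, hz, hmean⟩ := domain_mvt
    (fun z hz => (hf z hz).hasGradientAt.hasFDerivAt.hasFDerivWithinAt)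
    (convex_segment x y) (left_mem_segment ℝ x y) (right_mem_segment ℝ x y)
  calc f y - f x = inner ℝ (gradient f x) (y - x) +
        inner ℝ (gradient f z - gradient f x) (y - x) := by
        rw [hmean, InnerProductSpace.toDual_apply_apply, inner_sub_left, add_sub_cancel]
    _ ≤ inner ℝ (gradient f x) (y - x) + C * ‖y - x‖ := by
        gcongr
        exact (real_inner_le_norm _ _).trans (by gcongr; exact hC z hz)

/-! ### Local smoothness of the objective -/

section Parameters

theorem ofReal_le_extDiv_iff {w a b : ℝ} (ha : 0 < a) (hb : 0 ≤ b) :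
    ENNReal.ofReal w ≤ extDiv a b ↔ w * b ≤ a := by
  unfold extDiv
  rcases hb.eq_or_lt with rfl | hb
  · simp [ENNReal.div_zero, ha, ha.le]
  · rw [← ENNReal.ofReal_div_of_pos hb, ENNReal.ofReal_le_ofReal_iff (by positivity),
      le_div_iff₀ hb]

theorem ofReal_le_ofReal_mul_iff {w c : ℝ} {r : ℝ≥0∞} (hc : 0 < c) :
    ENNReal.ofReal w ≤ ENNReal.ofReal c * r ↔ ENNReal.ofReal (w / c) ≤ r := by
  rw [ENNReal.ofReal_div_of_pos hc, ENNReal.div_le_iff (by simpa using hc) ENNReal.ofReal_ne_top,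
    mul_comm]

theorem ofReal_le_div_ofReal_iff {w s : ℝ} {r : ℝ≥0∞} (hr : r ≠ 0) (hs : 0 ≤ s) :
    ENNReal.ofReal w ≤ r / ENNReal.ofReal s ↔ ENNReal.ofReal (w * s) ≤ r := by
  rw [ENNReal.le_div_iff_mul_le (.inr hr) (.inl ENNReal.ofReal_ne_top), ENNReal.ofReal_mul' hs]

theorem localRadius_ne_zero (ρ L₀ Lρ G : ℝ) : localRadius ρ L₀ Lρ G ≠ 0 := by
  have hentry (b : ℝ) : 0 < extDiv 1 b := by simp [extDiv]
  refine (lt_min (hentry _) ?_).ne'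
  split_ifs
  exacts [ENNReal.zero_lt_top, hentry _]

theorem ofReal_le_localRadius_iff {ρ L₀ Lρ G w : ℝ} (hL₀ : 0 ≤ L₀) (hLρ : 0 ≤ Lρ) (hG : 0 < G) :
    ENNReal.ofReal w ≤ localRadius ρ L₀ Lρ G ↔ w * (5 * Lρ * G ^ (ρ - 1)) ≤ 1 ∧
      (ρ ≠ 0 → L₀ ≠ 0 → w * (5 * (L₀ ^ (ρ - 1) * Lρ) ^ (1 / ρ)) ≤ 1) := by
  rw [localRadius, le_min_iff, ofReal_le_extDiv_iff one_pos (by positivity)]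
  split_ifs with hcase
  · simp only [le_top]
    tauto
  · rw [ofReal_le_extDiv_iff one_pos (by positivity)]
    tauto

theorem effSmooth_nonneg {ρ L₀ Lρ G : ℝ} (hL₀ : 0 ≤ L₀) (hLρ : 0 ≤ Lρ) (hG : 0 ≤ G) :
    0 ≤ effSmooth ρ L₀ Lρ G := by
  unfold effSmooth
  positivity

end Parameters

section LocalSmoothness

theorem rpow_add_le_two_mul {x y ρ : ℝ} (hx : 0 ≤ x) (hy : 0 ≤ y) (hρ : 0 ≤ ρ) (hρ2 : ρ ≤ 2) :
    (x + y) ^ ρ ≤ 2 * (x ^ ρ + y ^ ρ) := by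
  lift x to NNReal using hx
  lift y to NNReal using hy
  norm_cast
  rcases le_total ρ 1 with hρ1 | hρ1
  · exact (NNReal.rpow_add_le_add_rpow x y hρ hρ1).trans (le_mul_of_one_le_left' one_le_two)
  · refine (NNReal.rpow_add_le_mul_rpow_add_rpow x y hρ1).trans ?_
    gcongr
    calc (2 : NNReal) ^ (ρ - 1) ≤ 2 ^ (1 : ℝ) :=
          NNReal.rpow_le_rpow_of_exponent_le one_le_two (by linarith)
      _ = 2 := NNReal.rpow_one 2

/-- The gradient norm `(L₀ / Lρ) ^ (1 / ρ)` at which the two terms of the Hessian bound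
`L₀ + Lρ ‖∇f‖ ^ ρ` are equal. -/
noncomputable def balanceNorm (ρ L₀ Lρ : ℝ) : ℝ :=
  (L₀ / Lρ) ^ (1 / ρ)

variable {ρ L₀ Lρ G w : ℝ}

theorem mul_balanceNorm_rpow (hρ : 0 < ρ) (hL₀ : 0 ≤ L₀) (hLρ : 0 < Lρ) :
    Lρ * balanceNorm ρ L₀ Lρ ^ ρ = L₀ := by
  rw [balanceNorm, ← Real.rpow_mul (by positivity), one_div_mul_cancel hρ.ne', Real.rpow_one,
    mul_div_cancel₀ _ hLρ.ne']

theorem rpow_mul_balanceNorm (hρ : 0 < ρ) (hL₀ : 0 < L₀) (hLρ : 0 < Lρ) :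
    (L₀ ^ (ρ - 1) * Lρ) ^ (1 / ρ) * balanceNorm ρ L₀ Lρ = L₀ := by
  have hprod : L₀ ^ (ρ - 1) * Lρ * (L₀ / Lρ) = L₀ ^ ρ := by
    rw [mul_assoc, mul_div_cancel₀ _ hLρ.ne', ← Real.rpow_add_one hL₀.ne', sub_add_cancel]
  rw [balanceNorm, ← Real.mul_rpow (by positivity) (by positivity), hprod,
    ← Real.rpow_mul hL₀.le, mul_one_div_cancel hρ.ne', Real.rpow_one]

theorem mul_rpow_mul_le_of_le_localRadius (hL₀ : 0 ≤ L₀) (hLρ : 0 ≤ Lρ) (hG : 0 < G)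
    (hw : ENNReal.ofReal (2 * w) ≤ localRadius ρ L₀ Lρ G) : Lρ * G ^ ρ * w ≤ G / 10 := by
  have hentry := ((ofReal_le_localRadius_iff hL₀ hLρ hG).1 hw).1
  calc Lρ * G ^ ρ * w = 2 * w * (5 * Lρ * G ^ (ρ - 1)) * (G / 10) := by
        rw [Real.rpow_sub_one hG.ne']
        field_simp
        ring
    _ ≤ G / 10 := mul_le_of_le_one_left (by positivity) hentry

theorem mul_le_balanceNorm_of_le_localRadius (hρ : 0 < ρ) (hL₀ : 0 ≤ L₀) (hLρ : 0 < Lρ)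
    (hG : 0 < G) (hw : ENNReal.ofReal (2 * w) ≤ localRadius ρ L₀ Lρ G) :
    L₀ * w ≤ balanceNorm ρ L₀ Lρ / 10 := by
  have hbal : 0 ≤ balanceNorm ρ L₀ Lρ := by
    unfold balanceNorm
    positivity
  rcases hL₀.eq_or_lt with rfl | hL₀pos
  · simpa using by positivity
  have hentry := ((ofReal_le_localRadius_iff hL₀ hLρ.le hG).1 hw).2 hρ.ne' hL₀pos.ne'
  calc L₀ * w = 2 * w * (5 * (L₀ ^ (ρ - 1) * Lρ) ^ (1 / ρ)) * (balanceNorm ρ L₀ Lρ / 10) := by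
        linear_combination (-w) * rpow_mul_balanceNorm hρ hL₀pos hLρ
    _ ≤ balanceNorm ρ L₀ Lρ / 10 := mul_le_of_le_one_left (by positivity) hentry

/-- With `a = max G (balanceNorm ρ L₀ Lρ)` both terms of the Hessian bound at gradient norm `G + a`
are controlled by their values at `G` and at the balance point. -/
theorem exists_gradient_slack (hρ : 0 ≤ ρ) (hρ2 : ρ ≤ 2) (hL₀ : 0 ≤ L₀) (hLρ : 0 ≤ Lρ)
    (hG : 0 < G) (hw0 : 0 ≤ w) (hw : ENNReal.ofReal (2 * w) ≤ localRadius ρ L₀ Lρ G) :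
    ∃ a : ℝ, 0 < a ∧ (L₀ + Lρ * (G + a) ^ ρ) * w < a ∧
      L₀ + Lρ * (G + a) ^ ρ ≤ effSmooth ρ L₀ Lρ G := by
  unfold effSmooth
  rcases hρ.eq_or_lt with rfl | hρpos
  · exact ⟨(L₀ + Lρ) * w + 1, by positivity, by simp, by simp only [Real.rpow_zero]; linarith⟩
  rcases hLρ.eq_or_lt with rfl | hLρpos
  · exact ⟨L₀ * w + 1, by positivity, by simp, by linarith⟩
  set b := balanceNorm ρ L₀ Lρ
  have hb : 0 ≤ b := Real.rpow_nonneg (by positivity) _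
  have hmax : (G ⊔ b) ^ ρ ≤ G ^ ρ + b ^ ρ := by
    rcases max_choice G b with hGb | hGb <;> rw [hGb] <;>
      linarith [Real.rpow_nonneg hG.le ρ, Real.rpow_nonneg hb ρ]
  have hbound : L₀ + Lρ * (G + G ⊔ b) ^ ρ ≤ 3 * L₀ + 4 * (Lρ * G ^ ρ) := calc
    L₀ + Lρ * (G + G ⊔ b) ^ ρ ≤ L₀ + Lρ * (2 * (G ^ ρ + (G ^ ρ + b ^ ρ))) := by
        gcongr
        exact (rpow_add_le_two_mul hG.le (by positivity) hρ hρ2).trans (by gcongr)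
    _ = 3 * L₀ + 4 * (Lρ * G ^ ρ) := by
        linear_combination 2 * mul_balanceNorm_rpow hρpos hL₀ hLρpos
  refine ⟨G ⊔ b, lt_max_of_lt_left hG, ?_, by linarith⟩
  calc (L₀ + Lρ * (G + G ⊔ b) ^ ρ) * w ≤ (3 * L₀ + 4 * (Lρ * G ^ ρ)) * w := by gcongr
    _ = 3 * (L₀ * w) + 4 * (Lρ * G ^ ρ * w) := by ring
    _ ≤ 3 * (b / 10) + 4 * (G / 10) := by
        gcongr
        exacts [mul_le_balanceNorm_of_le_localRadius hρpos hL₀ hLρpos hG hw,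
          mul_rpow_mul_le_of_le_localRadius hL₀ hLρ hG hw]
    _ < G ⊔ b := by linarith [le_max_left G b, le_max_right G b]

/-- The assumptions of the theorem on the objective: a differentiable function on the open set `U`
that is bounded below and `(L₀, Lρ)`-smooth with exponent `0 ≤ ρ < 2`. -/
structure IsSmoothObjective {d : ℕ} (U : Set (RVec d)) (f : RVec d → ℝ) (ρ L₀ Lρ : ℝ) : Prop where
  isOpen : IsOpen U
  differentiableAt : ∀ x ∈ U, DifferentiableAt ℝ f x
  bddBelow : BddBelow (f '' U)
  exponent_nonneg : 0 ≤ ρ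
  exponent_lt_two : ρ < 2
  L₀_nonneg : 0 ≤ L₀
  Lρ_nonneg : 0 ≤ Lρ
  smooth : IsL0LrhoSmooth U f ρ L₀ Lρ

namespace IsSmoothObjective

variable {d : ℕ} {U : Set (RVec d)} {f : RVec d → ℝ} {x y : RVec d}

theorem norm_gradient_sub_le (hf : IsSmoothObjective U f ρ L₀ Lρ) (hG : 0 < G)
    (hxy : segment ℝ x y ⊆ U) (hx : ‖gradient f x‖ ≤ G)
    (hshort : ENNReal.ofReal (2 * ‖y - x‖) ≤ localRadius ρ L₀ Lρ G) :
    ‖gradient f y - gradient f x‖ ≤ effSmooth ρ L₀ Lρ G * ‖y - x‖ := by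
  obtain ⟨a, ha, hshort_a, hrate⟩ := exists_gradient_slack hf.exponent_nonneg
    hf.exponent_lt_two.le hf.L₀_nonneg hf.Lρ_nonneg hG (norm_nonneg _) hshort
  have hmono : MonotoneOn (fun s => L₀ + Lρ * s ^ ρ) (Set.Ici 0) := fun s hs t _ hst => by
    have := Set.mem_Ici.1 hs
    have := hf.Lρ_nonneg
    have := hf.exponent_nonneg
    dsimp only
    gcongr
  have hincr := norm_add_sub_le_of_short_step (x := x) (v := y - x) hf.isOpen hf.smooth.1 hmono
    hf.smooth.2 (fun s hs => hxy (by rw [segment_eq_image']; exact ⟨s, hs, rfl⟩)) hx ha hshort_a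
  rw [add_sub_cancel] at hincr
  exact hincr.trans (by gcongr)

theorem sub_le_inner_gradient_add (hf : IsSmoothObjective U f ρ L₀ Lρ) (hG : 0 < G)
    (hxy : segment ℝ x y ⊆ U) (hx : ‖gradient f x‖ ≤ G)
    (hshort : ENNReal.ofReal (2 * ‖y - x‖) ≤ localRadius ρ L₀ Lρ G) :
    f y - f x ≤ inner ℝ (gradient f x) (y - x) + effSmooth ρ L₀ Lρ G * ‖y - x‖ ^ 2 := by
  rw [pow_two, ← mul_assoc]
  refine _root_.sub_le_inner_gradient_add (fun z hz => hf.differentiableAt z (hxy hz))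
    fun z hz => ?_
  have hzx : ‖z - x‖ ≤ ‖y - x‖ := norm_sub_le_of_mem_segment hz
  have hxz : segment ℝ x z ⊆ U :=
    ((convex_segment x y).segment_subset (left_mem_segment ℝ x y) hz).trans hxy
  have hL : 0 ≤ effSmooth ρ L₀ Lρ G := effSmooth_nonneg hf.L₀_nonneg hf.Lρ_nonneg hG.le
  exact (hf.norm_gradient_sub_le hG hxz hx ((by gcongr :
    ENNReal.ofReal (2 * ‖z - x‖) ≤ ENNReal.ofReal (2 * ‖y - x‖)).trans hshort)).trans (by gcongr)

end IsSmoothObjective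

end LocalSmoothness

/-! ### Descent along Adam trajectories -/

section ExponentialAverage

/-- The weighted averages `e₀ = u₀`, `eₖ₊₁ = (1 - αₖ₊₁) eₖ + αₖ₊₁ uₖ₊₁` of a sequence `u`. The
bias-corrected momenta of Adam are of this form, with time-dependent weights `α`. -/
def expAverage {E : Type*} [AddCommGroup E] [Module ℝ E] (α : ℕ → ℝ) (u : ℕ → E) : ℕ → E
  | 0 => u 0
  | k + 1 => (1 - α (k + 1)) • expAverage α u k + α (k + 1) • u (k + 1)

theorem expAverage_apply {ι : Type*} (α : ℕ → ℝ) (u : ℕ → EuclideanSpace ℝ ι) (k : ℕ) (i : ι) :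
    expAverage α u k i = expAverage α (fun j => u j i) k := by
  induction k with
  | zero => rfl
  | succ k ih => simp [expAverage, ih]

theorem expAverage_add {E : Type*} [AddCommGroup E] [Module ℝ E] (α : ℕ → ℝ) (u v : ℕ → E)
    (k : ℕ) : expAverage α (fun j => u j + v j) k = expAverage α u k + expAverage α v k := by
  induction k with
  | zero => rfl
  | succ k ih =>
    simp only [expAverage, ih]
    module

theorem expAverage_mem {E : Type*} [AddCommGroup E] [Module ℝ E] {α : ℕ → ℝ} {u : ℕ → E}
    {s : Set E} (hs : Convex ℝ s) (hα : ∀ k, α k ∈ Set.Icc 0 1) {k : ℕ} (hu : ∀ j ≤ k, u j ∈ s) :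
    expAverage α u k ∈ s := by
  induction k with
  | zero => exact hu 0 le_rfl
  | succ k ih =>
    exact hs (ih fun j hj => hu j (hj.trans k.le_succ)) (hu _ le_rfl)
      (sub_nonneg.2 (hα _).2) (hα _).1 (sub_add_cancel _ _)

theorem norm_expAverage_le {E : Type*} [NormedAddCommGroup E] [NormedSpace ℝ E] {α : ℕ → ℝ}
    {u : ℕ → E} {c : ℝ} (hα : ∀ k, α k ∈ Set.Icc 0 1) {k : ℕ} (hu : ∀ j ≤ k, ‖u j‖ ≤ c) :
    ‖expAverage α u k‖ ≤ c := by
  rw [← mem_closedBall_zero_iff]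
  exact expAverage_mem (convex_closedBall 0 c) hα fun j hj => mem_closedBall_zero_iff.2 (hu j hj)

theorem map_expAverage_le_of_convexOn {E : Type*} [AddCommGroup E] [Module ℝ E] {α : ℕ → ℝ}
    {u : ℕ → E} {s : Set E} {φ : E → ℝ} (hφ : ConvexOn ℝ s φ) (hα : ∀ k, α k ∈ Set.Icc 0 1)
    {k : ℕ} (hu : ∀ j ≤ k, u j ∈ s) :
    φ (expAverage α u k) ≤ expAverage α (fun j => φ (u j)) k := by
  induction k with
  | zero => rfl
  | succ k ih =>
    have hu' : ∀ j ≤ k, u j ∈ s := fun j hj => hu j (hj.trans k.le_succ)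
    refine (hφ.2 (expAverage_mem hφ.1 hα hu') (hu _ le_rfl)
      (sub_nonneg.2 (hα (k + 1)).2) (hα _).1 (sub_add_cancel _ _)).trans ?_
    simp only [expAverage, smul_eq_mul]
    exact add_le_add_left (mul_le_mul_of_nonneg_left (ih hu') (sub_nonneg.2 (hα _).2)) _

variable {E : Type*} [NormedAddCommGroup E] [NormedSpace ℝ E] {α : ℕ → ℝ} {β : ℝ}

theorem mul_sq_norm_smul_add_le {a : ℝ} (hβ : 0 ≤ β) (hβa : β ≤ a) (ha : a ≤ 1) (x w : E) :
    β * ‖(1 - a) • (x + w)‖ ^ 2 ≤ β * (1 - β) * ‖x‖ ^ 2 + ‖w‖ ^ 2 := by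
  have hβ1 : 0 ≤ 1 - β := by linarith
  have hcontract : ‖(1 - a) • (x + w)‖ ≤ (1 - β) * (‖x‖ + ‖w‖) := by
    rw [norm_smul, Real.norm_of_nonneg (by linarith)]
    gcongr
    exact norm_add_le x w
  calc β * ‖(1 - a) • (x + w)‖ ^ 2 ≤ β * ((1 - β) * (‖x‖ + ‖w‖)) ^ 2 := by gcongr
    _ = β * (1 - β) * ‖x‖ ^ 2 + (1 - β) ^ 2 * ‖w‖ ^ 2 -
        (1 - β) * (β * ‖x‖ - (1 - β) * ‖w‖) ^ 2 := by ring
    _ ≤ β * (1 - β) * ‖x‖ ^ 2 + 1 * ‖w‖ ^ 2 - 0 := by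
        gcongr
        exacts [pow_le_one₀ hβ1 (by linarith), by positivity]
    _ = β * (1 - β) * ‖x‖ ^ 2 + ‖w‖ ^ 2 := by ring

theorem sq_mul_sum_sq_norm_le_of_contraction {D w : ℕ → E} (hβ : 0 ≤ β) (hβα : ∀ k, β ≤ α k)
    (hα : ∀ k, α k ≤ 1) (hD0 : D 0 = 0) (hD : ∀ k, D (k + 1) = (1 - α (k + 1)) • (D k + w k))
    (t : ℕ) : β ^ 2 * ∑ k ∈ Finset.range t, ‖D k‖ ^ 2 ≤ ∑ k ∈ Finset.range t, ‖w k‖ ^ 2 := by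
  suffices hinv : β ^ 2 * ∑ k ∈ Finset.range t, ‖D k‖ ^ 2 + β * ‖D t‖ ^ 2 ≤
      ∑ k ∈ Finset.range t, ‖w k‖ ^ 2 from (le_add_of_nonneg_right (by positivity)).trans hinv
  induction t with
  | zero => simp [hD0]
  | succ t ih =>
    have hstep := mul_sq_norm_smul_add_le hβ (hβα (t + 1)) (hα _) (D t) (w t)
    rw [← hD] at hstep
    rw [Finset.sum_range_succ, Finset.sum_range_succ]
    linarith

theorem sq_mul_sum_sq_expAverage_sub_le (hβ : 0 ≤ β) (hβα : ∀ k, β ≤ α k) (hα : ∀ k, α k ≤ 1)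
    (u : ℕ → E) (t : ℕ) :
    β ^ 2 * ∑ k ∈ Finset.range t, ‖expAverage α u k - u k‖ ^ 2 ≤
      ∑ k ∈ Finset.range t, ‖u (k + 1) - u k‖ ^ 2 := by
  have hcontr := sq_mul_sum_sq_norm_le_of_contraction (D := fun k => expAverage α u k - u k)
    (w := fun k => u k - u (k + 1)) hβ hβα hα (sub_self _)
    (fun k => by simp only [expAverage]; module) t
  simpa only [norm_sub_rev] using hcontr

end ExponentialAverage

section Trajectory

/-- `y` is a trajectory of Adam with averaging weights `α` (for both momenta), step size `η`,
regularization `lam` and stochastic gradients `g`. -/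
def IsAdamTrajectory {d : ℕ} (α : ℕ → ℝ) (η lam : ℝ) (g y : ℕ → RVec d) : Prop :=
  ∀ k i, y (k + 1) i - y k i =
    -(η / (√(expAverage α (fun j => g j i ^ 2) k) + lam) * expAverage α g k i)

/-- The regime of the convergence proof: the averaging weights lie in `[β, 1]`, and for gradients
that are `L`-Lipschitz along the trajectory and bounded by `G` the step size `η` is so small that
the momentum can follow them. -/
structure IsAdamRegime (α : ℕ → ℝ) (β η lam L G : ℝ) : Prop where
  rate_pos : 0 < β
  rate_le_weight : ∀ k, β ≤ α k
  weight_le_one : ∀ k, α k ≤ 1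
  step_pos : 0 < η
  reg_pos : 0 < lam
  two_mul_reg_le : 2 * lam ≤ G
  smooth_nonneg : 0 ≤ L
  drift_le : L * η / (lam * β) ≤ 1 / 16
  drift_sq_le : G * (L * η / (lam * β)) ^ 2 ≤ lam / 128

/-- The first- and second-order consequences of `L`-smoothness for step `k` of a sequence of points
`y` with function values `F` and gradients `A`. -/
structure IsSmoothStep {E : Type*} [NormedAddCommGroup E] [InnerProductSpace ℝ E] (L : ℝ)
    (F : ℕ → ℝ) (A y : ℕ → E) (k : ℕ) : Prop where
  norm_sub_le : ‖A (k + 1) - A k‖ ≤ L * ‖y (k + 1) - y k‖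
  sub_le : F (k + 1) - F k ≤ inner ℝ (A k) (y (k + 1) - y k) + L * ‖y (k + 1) - y k‖ ^ 2

theorem scaled_descent_coord {h h₀ h₁ L a m : ℝ} (hh₀ : 0 ≤ h₀) (hlow : h₀ ≤ h) (hup : h ≤ h₁)
    (hL : 0 ≤ L) (hLh₁ : L * h₁ ≤ 1 / 8) :
    a * (-(h * m)) + L * (h * m) ^ 2 ≤ -(h₀ / 4) * a ^ 2 + h₁ * (m - a) ^ 2 := by
  have hh : 0 ≤ h := hh₀.trans hlow
  have hLh : L * h ≤ 1 / 8 := (mul_le_mul_of_nonneg_left hup hL).trans hLh₁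
  calc a * (-(h * m)) + L * (h * m) ^ 2 = h * (-(a * m) + L * h * m ^ 2) := by ring
    _ ≤ h * (-(a * m) + 1 / 8 * m ^ 2) := by gcongr
    _ = h * (-(1 / 4) * a ^ 2 + (m - a) ^ 2 - (3 * a - 2 * m) ^ 2 / 12 - 13 / 24 * m ^ 2) := by ring
    _ ≤ h * (-(1 / 4) * a ^ 2 + (m - a) ^ 2) := by
        gcongr
        linarith [sq_nonneg (3 * a - 2 * m), sq_nonneg m]
    _ = -(h / 4) * a ^ 2 + h * (m - a) ^ 2 := by ring
    _ ≤ -(h₀ / 4) * a ^ 2 + h₁ * (m - a) ^ 2 := by gcongr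

theorem IsAdamRegime.weight_mem {α : ℕ → ℝ} {β η lam L G : ℝ} (hr : IsAdamRegime α β η lam L G)
    (k : ℕ) : α k ∈ Set.Icc 0 1 :=
  ⟨hr.rate_pos.le.trans (hr.rate_le_weight k), hr.weight_le_one k⟩

namespace IsAdamTrajectory

variable {d : ℕ} {α : ℕ → ℝ} {β η lam L G : ℝ} {g y : ℕ → RVec d}

theorem norm_step_le (h : IsAdamTrajectory α η lam g y) (hα : ∀ k, α k ∈ Set.Icc 0 1)
    (hη : 0 ≤ η) (hlam : 0 < lam) (k : ℕ) : ‖y (k + 1) - y k‖ ≤ η * √d := by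
  have hcoord (i : Fin d) : ‖(y (k + 1) - y k) i‖ ≤ η := by
    have hden : 0 < √(expAverage α (fun j => g j i ^ 2) k) + lam := by positivity
    rw [PiLp.sub_apply, h, expAverage_apply, norm_neg, div_mul_eq_mul_div, norm_div, norm_mul,
      Real.norm_of_nonneg hη, Real.norm_of_nonneg hden.le, div_le_iff₀ hden]
    have hjensen := map_expAverage_le_of_convexOn (u := fun j => g j i) (k := k)
      (even_two.convexOn_pow (𝕜 := ℝ)) hα (fun _ _ => Set.mem_univ _)
    gcongr
    exact (Real.abs_le_sqrt hjensen).trans (le_add_of_nonneg_right hlam.le)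
  rw [EuclideanSpace.norm_eq, Real.sqrt_le_left (by positivity), mul_pow,
    Real.sq_sqrt (Nat.cast_nonneg d)]
  calc ∑ i, ‖(y (k + 1) - y k) i‖ ^ 2 ≤ ∑ _i : Fin d, η ^ 2 := by
        gcongr with i
        exact hcoord i
    _ = η ^ 2 * d := by rw [Finset.sum_const, Finset.card_univ, Fintype.card_fin, nsmul_eq_mul,
        mul_comm]

theorem norm_step_le_norm_expAverage (h : IsAdamTrajectory α η lam g y) (hη : 0 ≤ η)
    (hlam : 0 < lam) (k : ℕ) : ‖y (k + 1) - y k‖ ≤ η / lam * ‖expAverage α g k‖ := by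
  refine le_of_sq_le_sq ?_ (by positivity)
  rw [mul_pow, EuclideanSpace.norm_sq_eq, EuclideanSpace.norm_sq_eq, Finset.mul_sum]
  gcongr with i
  rw [← mul_pow, PiLp.sub_apply, h, norm_neg, norm_mul, Real.norm_of_nonneg (by positivity)]
  gcongr
  exact le_add_of_nonneg_left (Real.sqrt_nonneg _)

theorem inner_step_add_le (h : IsAdamTrajectory α η lam g y) (hα : ∀ k, α k ∈ Set.Icc 0 1)
    (hη : 0 ≤ η) (hlam : 0 < lam) (hG : 2 * lam ≤ G) (hL : 0 ≤ L) (hLη : L * (η / lam) ≤ 1 / 8)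
    {k : ℕ} (hg : ∀ j ≤ k, ‖g j‖ ≤ 3 / 2 * G) (A : RVec d) :
    inner ℝ A (y (k + 1) - y k) + L * ‖y (k + 1) - y k‖ ^ 2 ≤
      -(η / (8 * G)) * ‖A‖ ^ 2 + η / lam * ‖expAverage α g k - A‖ ^ 2 := by
  have hG0 : 0 < G := by linarith
  rw [EuclideanSpace.norm_sq_eq, EuclideanSpace.norm_sq_eq, EuclideanSpace.norm_sq_eq,
    PiLp.inner_apply, Finset.mul_sum, Finset.mul_sum, Finset.mul_sum, ← Finset.sum_add_distrib,
    ← Finset.sum_add_distrib]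
  refine Finset.sum_le_sum fun i _ => ?_
  have hsqrt0 := Real.sqrt_nonneg (expAverage α (fun j => g j i ^ 2) k)
  have hsqrt : √(expAverage α (fun j => g j i ^ 2) k) ≤ 3 / 2 * G := by
    refine Real.sqrt_le_iff.2 ⟨by positivity, (le_abs_self _).trans
      (norm_expAverage_le (u := fun j => g j i ^ 2) hα fun j hj => ?_)⟩
    rw [norm_pow]
    gcongr
    exact (PiLp.norm_apply_le (g j) i).trans (hg j hj)
  have hcoord := scaled_descent_coord (a := A i) (m := expAverage α g k i) (h₀ := η / (2 * G))
    (h := η / (√(expAverage α (fun j => g j i ^ 2) k) + lam)) (by positivity)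
    (by gcongr; linarith) (by gcongr; linarith) hL hLη
  have hinner (b c : ℝ) : inner ℝ b c = b * c := mul_comm c b
  have hcoef : η / (2 * G) / 4 = η / (8 * G) := by ring
  simpa only [PiLp.sub_apply, Real.norm_eq_abs, sq_abs, hinner, h k i, neg_sq, hcoef] using hcoord

variable {F : ℕ → ℝ} {A n : ℕ → RVec d} {t : ℕ}

theorem sum_sq_norm_le_add_sum_sq_error (h : IsAdamTrajectory α η lam (fun k => A k + n k) y)
    (hr : IsAdamRegime α β η lam L G) (hg : ∀ k < t, ‖A k + n k‖ ≤ 3 / 2 * G)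
    (hs : ∀ k < t, IsSmoothStep L F A y k) :
    ∑ k ∈ Finset.range t, ‖A k‖ ^ 2 ≤ 8 * G / η * (F 0 - F t) + 8 * G / lam *
      ∑ k ∈ Finset.range t, ‖expAverage α (fun j => A j + n j) k - A k‖ ^ 2 := by
  have hη := hr.step_pos
  have hlam := hr.reg_pos
  have hG : 0 < G := by linarith [hr.two_mul_reg_le]
  have hβ := hr.rate_pos
  have hβ1 : β ≤ 1 := (hr.rate_le_weight 0).trans (hr.weight_le_one 0)
  have hLη : L * (η / lam) ≤ 1 / 8 := calc
    L * (η / lam) = β * (L * η / (lam * β)) := by field_simp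
    _ ≤ β * (1 / 16) := mul_le_mul_of_nonneg_left hr.drift_le hβ.le
    _ ≤ 1 / 8 := by linarith
  have hdescent := Finset.sum_le_sum fun k (hk : k ∈ Finset.range t) =>
    (hs k (Finset.mem_range.1 hk)).sub_le.trans
      (h.inner_step_add_le hr.weight_mem hη.le hlam hr.two_mul_reg_le hr.smooth_nonneg hLη
        (fun j hj => hg j (hj.trans_lt (Finset.mem_range.1 hk))) (A k))
  rw [Finset.sum_range_sub, Finset.sum_add_distrib, ← Finset.mul_sum,
    ← Finset.mul_sum] at hdescent
  generalize ∑ k ∈ Finset.range t, ‖A k‖ ^ 2 = S at *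
  generalize ∑ k ∈ Finset.range t, ‖expAverage α (fun j => A j + n j) k - A k‖ ^ 2 = R at *
  calc S = 8 * G / η * (η / (8 * G) * S) := by field_simp
    _ ≤ 8 * G / η * (F 0 - F t + η / lam * R) := by gcongr; linarith
    _ = 8 * G / η * (F 0 - F t) + 8 * G / lam * R := by field_simp

theorem sq_norm_drift_le (h : IsAdamTrajectory α η lam g y) (hη : 0 ≤ η) (hlam : 0 < lam)
    (hL : 0 ≤ L) {k : ℕ} (hs : ‖A (k + 1) - A k‖ ≤ L * ‖y (k + 1) - y k‖) :
    ‖A (k + 1) - A k‖ ^ 2 ≤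
      2 * (L * η / lam) ^ 2 * (‖A k‖ ^ 2 + ‖expAverage α g k - A k‖ ^ 2) := by
  have hM : ‖expAverage α g k‖ ≤ ‖A k‖ + ‖expAverage α g k - A k‖ :=
    norm_le_norm_add_norm_sub' _ _
  calc ‖A (k + 1) - A k‖ ^ 2
      ≤ (L * (η / lam * (‖A k‖ + ‖expAverage α g k - A k‖))) ^ 2 := by
        gcongr
        refine hs.trans (mul_le_mul_of_nonneg_left ?_ hL)
        exact (h.norm_step_le_norm_expAverage hη hlam k).trans (by gcongr)
    _ = (L * η / lam) ^ 2 * (‖A k‖ + ‖expAverage α g k - A k‖) ^ 2 := by ring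
    _ ≤ (L * η / lam) ^ 2 * (2 * (‖A k‖ ^ 2 + ‖expAverage α g k - A k‖ ^ 2)) := by
        gcongr
        exact add_sq_le
    _ = _ := by ring

theorem sum_sq_momentum_error_le (h : IsAdamTrajectory α η lam (fun k => A k + n k) y)
    (hr : IsAdamRegime α β η lam L G)
    (hs : ∀ k < t, ‖A (k + 1) - A k‖ ≤ L * ‖y (k + 1) - y k‖) :
    ∑ k ∈ Finset.range t, ‖expAverage α (fun j => A j + n j) k - A k‖ ^ 2 ≤
      8 * (L * η / (lam * β)) ^ 2 * ∑ k ∈ Finset.range t, ‖A k‖ ^ 2 +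
        4 * ∑ k ∈ Finset.range t, ‖expAverage α n k‖ ^ 2 := by
  have hβ := hr.rate_pos
  have hlam := hr.reg_pos
  have hsplit : ∑ k ∈ Finset.range t, ‖expAverage α (fun j => A j + n j) k - A k‖ ^ 2 ≤
      2 * ∑ k ∈ Finset.range t, ‖expAverage α A k - A k‖ ^ 2 +
        2 * ∑ k ∈ Finset.range t, ‖expAverage α n k‖ ^ 2 := by
    rw [Finset.mul_sum, Finset.mul_sum, ← Finset.sum_add_distrib]
    gcongr with k
    rw [expAverage_add, add_sub_right_comm, ← mul_add]
    exact (pow_le_pow_left₀ (norm_nonneg _) (norm_add_le _ _) 2).trans add_sq_le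
  have hlag := (sq_mul_sum_sq_expAverage_sub_le hβ.le hr.rate_le_weight hr.weight_le_one A t).trans
    (Finset.sum_le_sum fun k hk => h.sq_norm_drift_le hr.step_pos.le hlam hr.smooth_nonneg
      (hs k (Finset.mem_range.1 hk)))
  rw [← Finset.mul_sum, Finset.sum_add_distrib] at hlag
  set S := ∑ k ∈ Finset.range t, ‖A k‖ ^ 2
  set R := ∑ k ∈ Finset.range t, ‖expAverage α (fun j => A j + n j) k - A k‖ ^ 2
  generalize ∑ k ∈ Finset.range t, ‖expAverage α A k - A k‖ ^ 2 = D at *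
  have hR : 0 ≤ R := Finset.sum_nonneg fun _ _ => sq_nonneg _
  set s := L * η / (lam * β) with hs_def
  have hs0 : 0 ≤ s := div_nonneg (mul_nonneg hr.smooth_nonneg hr.step_pos.le) (by positivity)
  have hD : D ≤ 2 * s ^ 2 * (S + R) := by
    have hsβ : L * η / lam = β * s := by rw [hs_def]; field_simp
    rw [hsβ] at hlag
    exact le_of_mul_le_mul_left (hlag.trans_eq (by ring)) (by positivity : 0 < β ^ 2)
  have hs2 : s ^ 2 * R ≤ (1 / 16) ^ 2 * R := by
    gcongr
    exact hr.drift_le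
  linarith

theorem sum_sq_norm_le (h : IsAdamTrajectory α η lam (fun k => A k + n k) y)
    (hr : IsAdamRegime α β η lam L G) (hg : ∀ k < t, ‖A k + n k‖ ≤ 3 / 2 * G)
    (hs : ∀ k < t, IsSmoothStep L F A y k) :
    ∑ k ∈ Finset.range t, ‖A k‖ ^ 2 ≤ 16 * G / η * (F 0 - F t) +
      64 * G / lam * ∑ k ∈ Finset.range t, ‖expAverage α n k‖ ^ 2 := by
  have hlam := hr.reg_pos
  have hG : 0 < G := by linarith [hr.two_mul_reg_le]
  have hdescent := h.sum_sq_norm_le_add_sum_sq_error hr hg hs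
  have herror := h.sum_sq_momentum_error_le hr fun k hk => (hs k hk).norm_sub_le
  set S := ∑ k ∈ Finset.range t, ‖A k‖ ^ 2
  set N := ∑ k ∈ Finset.range t, ‖expAverage α n k‖ ^ 2
  set s := L * η / (lam * β)
  have habsorb : 8 * G / lam * (8 * s ^ 2 * S + 4 * N) ≤ S / 2 + 32 * G / lam * N := calc
    _ = 64 / lam * (G * s ^ 2) * S + 32 * G / lam * N := by ring
    _ ≤ 64 / lam * (lam / 128) * S + 32 * G / lam * N := by
      gcongr
      exact hr.drift_sq_le
    _ = S / 2 + 32 * G / lam * N := by field_simp; ring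
  have herror' := mul_le_mul_of_nonneg_left herror (by positivity : 0 ≤ 8 * G / lam)
  calc S ≤ 2 * (8 * G / η * (F 0 - F t) + 32 * G / lam * N) := by linarith
    _ = 16 * G / η * (F 0 - F t) + 64 * G / lam * N := by ring

end IsAdamTrajectory

section Growth

variable {E : Type*} [SeminormedAddCommGroup E] {A : ℕ → E} {G κ : ℝ}

/-- While `‖A k‖ ≥ G / 2`, a step of length at most `κ` is paid for by the term `‖A k‖ ^ 2` of the
sum. -/
theorem norm_le_add_sum_sq_norm (hG : 0 < G) (hκ : κ ≤ G / 4) (hA0 : 2 * ‖A 0‖ ≤ G) {t : ℕ}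
    (hstep : ∀ k < t, ‖A (k + 1) - A k‖ ≤ κ) :
    ‖A t‖ ≤ 3 / 4 * G + 4 * κ / G ^ 2 * ∑ k ∈ Finset.range t, ‖A k‖ ^ 2 := by
  induction t with
  | zero => simp only [Finset.range_zero, Finset.sum_empty]; linarith
  | succ t ih =>
    have hκ0 : 0 ≤ κ := (norm_nonneg _).trans (hstep t t.lt_succ_self)
    have hnext : ‖A (t + 1)‖ ≤ ‖A t‖ + κ :=
      (norm_le_norm_add_norm_sub' _ _).trans (add_le_add_right (hstep t t.lt_succ_self) _)
    rcases le_total ‖A t‖ (G / 2) with hsmall | hlarge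
    · have hnonneg : 0 ≤ 4 * κ / G ^ 2 * ∑ k ∈ Finset.range (t + 1), ‖A k‖ ^ 2 := by positivity
      linarith
    · have hpaid : κ ≤ 4 * κ / G ^ 2 * ‖A t‖ ^ 2 := calc
        κ = 4 * κ / G ^ 2 * (G / 2) ^ 2 := by field_simp; ring
        _ ≤ 4 * κ / G ^ 2 * ‖A t‖ ^ 2 := by gcongr
      rw [Finset.sum_range_succ]
      linarith [ih fun k hk => hstep k (hk.trans t.lt_succ_self)]

theorem forall_norm_le_of_sum_sq_norm_le {S : ℝ} {T : ℕ} (hG : 0 < G) (hκ0 : 0 ≤ κ) (hκ : κ ≤ G / 4)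
    (hA0 : 2 * ‖A 0‖ ≤ G) (hstep : ∀ k < T, ‖A k‖ ≤ G → ‖A (k + 1) - A k‖ ≤ κ)
    (hsum : ∀ t ≤ T, (∀ k < t, ‖A k‖ ≤ G) → ∑ k ∈ Finset.range t, ‖A k‖ ^ 2 ≤ S)
    (hS : 16 * κ * S ≤ G ^ 3) : ∀ t ≤ T, ‖A t‖ ≤ G := by
  intro t
  induction t using Nat.strong_induction_on with
  | _ t ih =>
    intro ht
    have hbefore : ∀ k < t, ‖A k‖ ≤ G := fun k hk => ih k hk (hk.le.trans ht)
    calc ‖A t‖ ≤ 3 / 4 * G + 4 * κ / G ^ 2 * ∑ k ∈ Finset.range t, ‖A k‖ ^ 2 :=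
          norm_le_add_sum_sq_norm hG hκ hA0 fun k hk =>
            hstep k (hk.trans_le ht) (hbefore k hk)
      _ ≤ 3 / 4 * G + 4 * κ / G ^ 2 * S := by
          gcongr
          exact hsum t ht hbefore
      _ = 3 / 4 * G + 16 * κ * S / (4 * G ^ 2) := by field_simp; ring
      _ ≤ 3 / 4 * G + G ^ 3 / (4 * G ^ 2) := by gcongr
      _ = G := by field_simp; ring

end Growth

namespace IsAdamTrajectory

variable {d : ℕ} {α : ℕ → ℝ} {β η lam L G : ℝ} {y : ℕ → RVec d} {F : ℕ → ℝ} {A n : ℕ → RVec d}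

theorem forall_norm_le_and_sum_sq_norm_le {Δ Q : ℝ} {T : ℕ}
    (h : IsAdamTrajectory α η lam (fun k => A k + n k) y) (hr : IsAdamRegime α β η lam L G)
    (hstep : L * (η * √d) ≤ G / 4) (hn : ∀ k < T, ‖n k‖ ≤ G / 2) (hA0 : 2 * ‖A 0‖ ≤ G)
    (hs : ∀ k < T, ‖A k‖ ≤ G → IsSmoothStep L F A y k) (hF : ∀ k ≤ T, F 0 - F k ≤ Δ)
    (hQ : ∑ k ∈ Finset.range T, ‖expAverage α n k‖ ^ 2 ≤ Q)
    (hbudget : 16 * (L * (η * √d)) * (16 * G / η * Δ + 64 * G / lam * Q) ≤ G ^ 3) :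
    (∀ k ≤ T, ‖A k‖ ≤ G) ∧
      ∑ k ∈ Finset.range T, ‖A k‖ ^ 2 ≤ 16 * G / η * Δ + 64 * G / lam * Q := by
  have hη := hr.step_pos
  have hlam := hr.reg_pos
  have hL := hr.smooth_nonneg
  have hG : 0 < G := by linarith [hr.two_mul_reg_le]
  have hsum (t : ℕ) (ht : t ≤ T) (hA : ∀ k < t, ‖A k‖ ≤ G) :
      ∑ k ∈ Finset.range t, ‖A k‖ ^ 2 ≤ 16 * G / η * Δ + 64 * G / lam * Q := by
    have hg : ∀ k < t, ‖A k + n k‖ ≤ 3 / 2 * G := fun k hk => by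
      linarith [norm_add_le (A k) (n k), hA k hk, hn k (hk.trans_le ht)]
    refine (h.sum_sq_norm_le hr hg fun k hk => hs k (hk.trans_le ht) (hA k hk)).trans ?_
    gcongr
    · exact hF t ht
    · refine (Finset.sum_le_sum_of_subset_of_nonneg (Finset.range_mono ht)
        fun _ _ _ => by positivity).trans hQ
  have hA := forall_norm_le_of_sum_sq_norm_le hG (by positivity) hstep hA0
    (fun k hk hAk => (hs k hk hAk).norm_sub_le.trans
      (mul_le_mul_of_nonneg_left (h.norm_step_le hr.weight_mem hη.le hlam k) hL)) hsum hbudget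
  exact ⟨hA, hsum T le_rfl fun k hk => hA k hk.le⟩

end IsAdamTrajectory
end Trajectory

/-! ### Bias correction -/

section BiasCorrection

/-- The weight `β / (1 - (1 - β) ^ (k + 1))` of the newest gradient in the bias-corrected average
of iteration `k + 1`: the bias-corrected averages are the `expAverage`s with these weights. -/
noncomputable def biasWeight (β : ℝ) (k : ℕ) : ℝ := β / (1 - (1 - β) ^ (k + 1))

variable {β : ℝ}

theorem one_sub_one_sub_pow_pos (hβ : 0 < β) (hβ1 : β ≤ 1) (k : ℕ) :
    0 < 1 - (1 - β) ^ (k + 1) :=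
  sub_pos.2 (pow_lt_one₀ (by linarith) (by linarith) k.succ_ne_zero)

theorem le_biasWeight (hβ : 0 < β) (hβ1 : β ≤ 1) (k : ℕ) : β ≤ biasWeight β k :=
  le_div_self hβ.le (one_sub_one_sub_pow_pos hβ hβ1 k)
    (sub_le_self _ (pow_nonneg (by linarith) _))

theorem biasWeight_le_one (hβ : 0 < β) (hβ1 : β ≤ 1) (k : ℕ) : biasWeight β k ≤ 1 := by
  rw [biasWeight, div_le_one (one_sub_one_sub_pow_pos hβ hβ1 k)]
  have hpow : (1 - β) ^ (k + 1) ≤ 1 - β :=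
    pow_le_of_le_one (by linarith) (by linarith) k.succ_ne_zero
  linarith

theorem one_sub_pow_mul_one_add_le_one (hβ : 0 ≤ β) (hβ1 : β ≤ 1) (k : ℕ) :
    (1 - β) ^ k * (1 + k * β) ≤ 1 := by
  calc (1 - β) ^ k * (1 + k * β) ≤ (1 - β) ^ k * (1 + β) ^ k :=
        mul_le_mul_of_nonneg_left (one_add_mul_le_pow (by linarith) k)
          (pow_nonneg (by linarith) k)
    _ = (1 - β ^ 2) ^ k := by rw [← mul_pow]; ring
    _ ≤ 1 := pow_le_one₀ (by linarith [pow_le_one₀ hβ hβ1 (n := 2)])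
        (sub_le_self _ (sq_nonneg β))

theorem biasWeight_le (hβ : 0 < β) (hβ1 : β ≤ 1) (k : ℕ) :
    biasWeight β k ≤ β + ((k + 1 : ℕ) : ℝ)⁻¹ := by
  have hpow := one_sub_pow_mul_one_add_le_one hβ.le hβ1 (k + 1)
  rw [biasWeight, div_le_iff₀ (one_sub_one_sub_pow_pos hβ hβ1 k), ← sub_nonneg]
  have hid : (β + ((k + 1 : ℕ) : ℝ)⁻¹) * (1 - (1 - β) ^ (k + 1)) - β =
      ((k + 1 : ℕ) : ℝ)⁻¹ * (1 - (1 - β) ^ (k + 1) * (1 + (k + 1 : ℕ) * β)) := by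
    field_simp
    ring
  rw [hid]
  exact mul_nonneg (by positivity) (sub_nonneg.2 hpow)

theorem sum_inv_sq_le_two (T : ℕ) : ∑ k ∈ Finset.range T, (((k + 1 : ℕ) : ℝ) ^ 2)⁻¹ ≤ 2 := by
  have hbound := sum_Ioo_inv_sq_le (α := ℝ) 0 (T + 1)
  rwa [Nat.cast_zero, zero_add, div_one, ← Finset.Ico_add_one_left_eq_Ioo, ← Finset.sum_Ico_add',
    ← Finset.range_eq_Ico] at hbound

theorem sum_sq_biasWeight_le (hβ : 0 < β) (hβ1 : β ≤ 1) (T : ℕ) :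
    ∑ k ∈ Finset.range T, biasWeight β k ^ 2 ≤ 2 * (β ^ 2 * T) + 4 := calc
  _ ≤ ∑ k ∈ Finset.range T, (2 * β ^ 2 + 2 * (((k + 1 : ℕ) : ℝ) ^ 2)⁻¹) := by
    gcongr with k
    rw [← mul_add, ← inv_pow]
    exact (pow_le_pow_left₀ (hβ.le.trans (le_biasWeight hβ hβ1 k)) (biasWeight_le hβ hβ1 k) 2).trans
      add_sq_le
  _ = 2 * (β ^ 2 * T) + 2 * ∑ k ∈ Finset.range T, (((k + 1 : ℕ) : ℝ) ^ 2)⁻¹ := by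
    rw [Finset.sum_add_distrib, Finset.mul_sum, Finset.sum_const, Finset.card_range, nsmul_eq_mul,
      mul_left_comm, mul_comm (β ^ 2)]
  _ ≤ 2 * (β ^ 2 * T) + 4 := by linarith [sum_inv_sq_le_two T]

theorem div_one_sub_pow_eq_expAverage (hβ : 0 < β) (hβ1 : β ≤ 1) {s u : ℕ → ℝ}
    (hs0 : s 0 = 0) (hs : ∀ k, s (k + 1) = (1 - β) * s k + β * u k) (k : ℕ) :
    s (k + 1) / (1 - (1 - β) ^ (k + 1)) = expAverage (biasWeight β) u k := by
  induction k with
  | zero => simp only [hs, hs0, expAverage, zero_add, pow_one, sub_sub_cancel, mul_zero,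
      mul_div_cancel_left₀ _ hβ.ne']
  | succ k ih =>
    have hk := (one_sub_one_sub_pow_pos hβ hβ1 k).ne'
    have hk' := (one_sub_one_sub_pow_pos hβ hβ1 (k + 1)).ne'
    rw [hs, expAverage, ← ih, biasWeight, smul_eq_mul, smul_eq_mul]
    rw [pow_succ _ (k + 1)] at hk' ⊢
    generalize (1 - β) ^ (k + 1) = p at hk hk' ⊢
    have hweight : 1 - β / (1 - p * (1 - β)) = (1 - β) * (1 - p) / (1 - p * (1 - β)) := by
      rw [eq_div_iff hk', sub_mul, div_mul_cancel₀ _ hk']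
      ring
    rw [hweight, div_mul_div_comm, mul_right_comm, mul_div_mul_right _ _ hk, div_mul_eq_mul_div,
      add_div]

theorem isAdamTrajectory_adamIter {d : ℕ} {Ξ : Type v} {g : RVec d → Ξ → RVec d} {η lam : ℝ}
    {xinit : RVec d} {z : ℕ → Ξ} (hβ : 0 < β) (hβ1 : β ≤ 1) :
    IsAdamTrajectory (biasWeight β) η lam
      (fun k => g (adamIter g β β η lam xinit z (k + 1)) (z (k + 1)))
      (fun k => adamIter g β β η lam xinit z (k + 1)) := by
  intro k i
  have hm := div_one_sub_pow_eq_expAverage hβ hβ1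
    (s := fun k => (adamState g β β η lam xinit z k).m i)
    (u := fun k => g (adamIter g β β η lam xinit z (k + 1)) (z (k + 1)) i) rfl
    (fun k => rfl) k
  have hv := div_one_sub_pow_eq_expAverage hβ hβ1
    (s := fun k => (adamState g β β η lam xinit z k).v i)
    (u := fun k => g (adamIter g β β η lam xinit z (k + 1)) (z (k + 1)) i ^ 2) rfl
    (fun k => rfl) k
  rw [expAverage_apply, ← hm, ← hv]
  exact sub_sub_cancel_left _ _

end BiasCorrection

/-! ### Concentration of averaged noise -/

section Concentration

theorem exp_mul_le_of_abs_le {x c : ℝ} (hx : |x| ≤ c) (θ : ℝ) :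
    Real.exp (θ * x) ≤ Real.exp ((θ * c) ^ 2 / 2) + Real.sinh (θ * c) / c * x := by
  rcases ((abs_nonneg x).trans hx).eq_or_lt with rfl | hc
  · simp [abs_nonpos_iff.1 hx]
  · have hxc : |x / c| ≤ 1 := by rwa [abs_div, abs_of_pos hc, div_le_one hc]
    calc Real.exp (θ * x) = Real.exp (x / c * (θ * c)) := by
          rw [mul_comm θ c, ← mul_assoc, div_mul_cancel₀ _ hc.ne', mul_comm]
      _ ≤ Real.cosh (θ * c) + x / c * Real.sinh (θ * c) :=
          Real.exp_mul_le_cosh_add_mul_sinh hxc (θ * c)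
      _ ≤ Real.exp ((θ * c) ^ 2 / 2) + x / c * Real.sinh (θ * c) := by
          gcongr
          exact Real.cosh_le_exp_half_sq _
      _ = Real.exp ((θ * c) ^ 2 / 2) + Real.sinh (θ * c) / c * x := by ring

variable {Ω E : Type*} {m₀ : MeasurableSpace Ω} {μ : Measure Ω}

theorem integrable_mul_exp_of_abs_le {X Y : Ω → ℝ} {c : ℝ} (hY : Integrable Y μ)
    (hX : AEStronglyMeasurable X μ) (hXc : ∀ᵐ ω ∂μ, |X ω| ≤ c) (θ : ℝ) :
    Integrable (fun ω => Y ω * Real.exp (θ * X ω)) μ := by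
  refine hY.mul_bdd (c := Real.exp (|θ| * c))
    (Real.continuous_exp.comp_aestronglyMeasurable (hX.const_mul θ)) ?_
  filter_upwards [hXc] with ω hω
  rw [Real.norm_of_nonneg (Real.exp_nonneg _)]
  refine Real.exp_le_exp.2 ((le_abs_self _).trans ?_)
  rw [abs_mul]
  gcongr

theorem integral_mul_exp_le_of_condExp_eq_zero [IsFiniteMeasure μ] {m : MeasurableSpace Ω}
    (hm : m ≤ m₀) {X Y : Ω → ℝ} {c : ℝ} (hYm : StronglyMeasurable[m] Y) (hY : Integrable Y μ)
    (hY0 : 0 ≤ Y) (hX : AEStronglyMeasurable[m₀] X μ) (hXc : ∀ᵐ ω ∂μ, |X ω| ≤ c)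
    (hX0 : μ[X | m] =ᵐ[μ] 0) (θ : ℝ) :
    ∫ ω, Y ω * Real.exp (θ * X ω) ∂μ ≤ Real.exp ((θ * c) ^ 2 / 2) * ∫ ω, Y ω ∂μ := by
  have hYX : Integrable (fun ω => Y ω * X ω) μ := hY.mul_bdd hX hXc
  have hYX0 : ∫ ω, Y ω * X ω ∂μ = 0 := by
    have hpull := condExp_mul_of_stronglyMeasurable_left hYm hYX (Integrable.of_bound hX c hXc)
    rw [← integral_condExp hm]
    refine integral_eq_zero_of_ae (hpull.trans ?_)
    filter_upwards [hX0] with ω hω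
    simp [hω]
  set C := Real.exp ((θ * c) ^ 2 / 2)
  set b := Real.sinh (θ * c) / c
  calc ∫ ω, Y ω * Real.exp (θ * X ω) ∂μ ≤ ∫ ω, (C * Y ω + b * (Y ω * X ω)) ∂μ := by
        refine integral_mono_ae (integrable_mul_exp_of_abs_le hY hX hXc θ)
          ((hY.const_mul C).add (hYX.const_mul b)) ?_
        filter_upwards [hXc] with ω hω
        linarith [mul_le_mul_of_nonneg_left (exp_mul_le_of_abs_le hω θ) (hY0 ω)]
    _ = C * ∫ ω, Y ω ∂μ := by
        rw [integral_add (hY.const_mul C) (hYX.const_mul b), integral_const_mul,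
          integral_const_mul, hYX0, mul_zero, add_zero]

section Azuma

variable {𝓕 : Filtration ℕ m₀} {X : ℕ → Ω → ℝ} {c : ℕ → ℝ} {T : ℕ}

theorem integrable_exp_mul_sum [IsFiniteMeasure μ] (hX : ∀ k < T, AEStronglyMeasurable (X k) μ)
    (hXc : ∀ k < T, ∀ᵐ ω ∂μ, |X k ω| ≤ c k) (θ : ℝ) :
    Integrable (fun ω => Real.exp (θ * ∑ k ∈ Finset.range T, X k ω)) μ := by
  induction T with
  | zero => simp
  | succ T ih =>
    simp only [Finset.sum_range_succ, mul_add, Real.exp_add]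
    exact integrable_mul_exp_of_abs_le
      (ih (fun k hk => hX k (hk.trans T.lt_succ_self)) fun k hk => hXc k (hk.trans T.lt_succ_self))
      (hX T T.lt_succ_self) (hXc T T.lt_succ_self) θ

variable [IsProbabilityMeasure μ]

theorem mgf_sum_le_of_condExp_eq_zero (hX : ∀ k < T, StronglyMeasurable[𝓕 (k + 1)] (X k))
    (hXc : ∀ k < T, ∀ᵐ ω ∂μ, |X k ω| ≤ c k) (hX0 : ∀ k < T, μ[X k | 𝓕 k] =ᵐ[μ] 0) (θ : ℝ) :
    ProbabilityTheory.mgf (fun ω => ∑ k ∈ Finset.range T, X k ω) μ θ ≤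
      Real.exp (θ ^ 2 / 2 * ∑ k ∈ Finset.range T, c k ^ 2) := by
  induction T with
  | zero => simp [ProbabilityTheory.mgf]
  | succ T ih =>
    have hlt {k : ℕ} (hk : k < T) : k < T + 1 := hk.trans T.lt_succ_self
    have hpast : StronglyMeasurable[𝓕 T] fun ω => Real.exp (θ * ∑ k ∈ Finset.range T, X k ω) :=
      Real.continuous_exp.comp_stronglyMeasurable <| .const_mul
        (Finset.stronglyMeasurable_fun_sum _ fun k hk =>
          (hX k (hlt (Finset.mem_range.1 hk))).mono (𝓕.mono (Finset.mem_range.1 hk))) θ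
    have hmeas (k : ℕ) (hk : k < T + 1) : AEStronglyMeasurable (X k) μ :=
      ((hX k hk).mono (𝓕.le _)).aestronglyMeasurable
    have hstep := integral_mul_exp_le_of_condExp_eq_zero (𝓕.le T) hpast
      (integrable_exp_mul_sum (fun k hk => hmeas k (hlt hk)) (fun k hk => hXc k (hlt hk)) θ)
      (fun ω => Real.exp_nonneg _) (hmeas T T.lt_succ_self) (hXc T T.lt_succ_self)
      (hX0 T T.lt_succ_self) θ
    simp only [ProbabilityTheory.mgf, Finset.sum_range_succ, mul_add, Real.exp_add] at ih ⊢
    refine hstep.trans ?_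
    rw [mul_comm, mul_pow, mul_div_right_comm]
    gcongr
    exact ih (fun k hk => hX k (hlt hk)) (fun k hk => hXc k (hlt hk)) fun k hk => hX0 k (hlt hk)

/-- The Azuma–Hoeffding inequality; unlike `ProbabilityTheory.HasCondSubgaussianMGF` it does not
need a standard Borel space. -/
theorem measureReal_sum_ge_le_of_condExp_eq_zero
    (hX : ∀ k < T, StronglyMeasurable[𝓕 (k + 1)] (X k))
    (hXc : ∀ k < T, ∀ᵐ ω ∂μ, |X k ω| ≤ c k) (hX0 : ∀ k < T, μ[X k | 𝓕 k] =ᵐ[μ] 0) {V a : ℝ}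
    (hV : 0 < V) (ha : 0 ≤ a) (hcV : ∑ k ∈ Finset.range T, c k ^ 2 ≤ V) :
    μ.real {ω | a ≤ ∑ k ∈ Finset.range T, X k ω} ≤ Real.exp (-(a ^ 2 / (2 * V))) := by
  have hint := integrable_exp_mul_sum (μ := μ)
    (fun k hk => ((hX k hk).mono (𝓕.le _)).aestronglyMeasurable) hXc (a / V)
  calc _ ≤ Real.exp (-(a / V) * a) * ProbabilityTheory.mgf _ μ (a / V) :=
        ProbabilityTheory.measure_ge_le_exp_mul_mgf a (by positivity) hint
    _ ≤ Real.exp (-(a / V) * a) * Real.exp ((a / V) ^ 2 / 2 * V) := by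
        gcongr
        exact (mgf_sum_le_of_condExp_eq_zero hX hXc hX0 _).trans (by gcongr)
    _ = Real.exp (-(a ^ 2 / (2 * V))) := by
        rw [← Real.exp_add]
        congr 1
        field_simp
        ring

end Azuma

theorem condExp_inner_eq_zero [NormedAddCommGroup E] [InnerProductSpace ℝ E] [CompleteSpace E]
    {m : MeasurableSpace Ω} {W u : Ω → E} (hW : StronglyMeasurable[m] W)
    (hWu : Integrable (fun ω => inner ℝ (W ω) (u ω)) μ) (hu : Integrable u μ)
    (hu0 : μ[u | m] =ᵐ[μ] 0) : μ[fun ω => inner ℝ (W ω) (u ω) | m] =ᵐ[μ] 0 := by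
  refine (condExp_bilin_of_stronglyMeasurable_left (innerSL ℝ) hW hWu hu).trans ?_
  filter_upwards [hu0] with ω hω
  simp [hω]

end Concentration

section AveragedNoise

variable {E : Type*} [NormedAddCommGroup E] [InnerProductSpace ℝ E] {α : ℕ → ℝ} {β σ : ℝ}

theorem stronglyMeasurable_expAverage {Ω : Type*} {m : MeasurableSpace Ω} {u : ℕ → Ω → E} {k : ℕ}
    (hu : ∀ j ≤ k, StronglyMeasurable (u j)) :
    StronglyMeasurable fun ω => expAverage α (fun j => u j ω) k := by
  induction k with
  | zero => exact hu 0 le_rfl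
  | succ k ih =>
    exact ((ih fun j hj => hu j (hj.trans k.le_succ)).const_smul _).add
      ((hu (k + 1) le_rfl).const_smul _)

/-- The vectors `wₖ`, depending only on `uⱼ` for `j < k`, for which `⟪wₖ, uₖ⟫` is the cross term
in the expansion of `‖expAverage α u k‖ ^ 2`. -/
noncomputable def averageWeight (α : ℕ → ℝ) (u : ℕ → E) : ℕ → E
  | 0 => 0
  | k + 1 => (2 * α (k + 1) * (1 - α (k + 1))) • expAverage α u k

theorem stronglyMeasurable_averageWeight {Ω : Type*} {m : MeasurableSpace Ω} {u : ℕ → Ω → E}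
    {k : ℕ} (hu : ∀ j < k, StronglyMeasurable (u j)) :
    StronglyMeasurable fun ω => averageWeight α (fun j => u j ω) k := by
  cases k with
  | zero => exact stronglyMeasurable_zero
  | succ k =>
    exact (stronglyMeasurable_expAverage fun j hj => hu j (Nat.lt_succ_of_le hj)).const_smul _

theorem norm_averageWeight_le {u : ℕ → E} (hα : ∀ k, α k ∈ Set.Icc 0 1) {k : ℕ}
    (hu : ∀ j ≤ k, ‖u j‖ ≤ σ) : ‖averageWeight α u k‖ ≤ 2 * α k * σ := by
  have hσ : 0 ≤ σ := (norm_nonneg _).trans (hu k le_rfl)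
  have hαk := (hα k).1
  cases k with
  | zero =>
    rw [averageWeight, norm_zero]
    positivity
  | succ k =>
    have hα1 := sub_nonneg.2 (hα (k + 1)).2
    rw [averageWeight, norm_smul, Real.norm_of_nonneg (by positivity)]
    refine mul_le_mul (mul_le_of_le_one_right (by positivity) (sub_le_self _ hαk)) ?_
      (norm_nonneg _) (by positivity)
    exact norm_expAverage_le hα fun j hj => hu j (hj.trans k.le_succ)

theorem sq_norm_expAverage_succ_le {u : ℕ → E} {k : ℕ} (hβ : 0 ≤ β) (hβα : β ≤ α (k + 1))
    (hα : α (k + 1) ≤ 1) (hu : ‖u (k + 1)‖ ≤ σ) :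
    ‖expAverage α u (k + 1)‖ ^ 2 ≤ (1 - β) * ‖expAverage α u k‖ ^ 2 +
      inner ℝ (averageWeight α u (k + 1)) (u (k + 1)) + σ ^ 2 * α (k + 1) ^ 2 := by
  have hcontract : (1 - α (k + 1)) ^ 2 ≤ 1 - β :=
    (pow_le_of_le_one (by linarith) (by linarith) two_ne_zero).trans (by linarith)
  calc ‖expAverage α u (k + 1)‖ ^ 2
      = (1 - α (k + 1)) ^ 2 * ‖expAverage α u k‖ ^ 2 +
        inner ℝ (averageWeight α u (k + 1)) (u (k + 1)) + ‖u (k + 1)‖ ^ 2 * α (k + 1) ^ 2 := by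
        rw [expAverage, averageWeight, norm_add_sq_real, norm_smul, norm_smul, mul_pow, mul_pow,
          Real.norm_eq_abs, Real.norm_eq_abs, sq_abs, sq_abs, real_inner_smul_left,
          real_inner_smul_left, real_inner_smul_right]
        ring
    _ ≤ _ := by gcongr

theorem mul_sum_sq_norm_expAverage_le {u : ℕ → E} (hβ : 0 ≤ β) (hβα : ∀ k, β ≤ α k)
    (hα : ∀ k, α k ≤ 1) {T : ℕ} (hu : ∀ k < T, ‖u k‖ ≤ σ) :
    β * ∑ k ∈ Finset.range T, ‖expAverage α u k‖ ^ 2 ≤ σ ^ 2 +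
      σ ^ 2 * ∑ k ∈ Finset.range T, α k ^ 2 +
      ∑ k ∈ Finset.range T, inner ℝ (averageWeight α u k) (u k) := by
  rcases T with _ | T
  · simp only [Finset.range_zero, Finset.sum_empty, mul_zero, add_zero]
    exact sq_nonneg σ
  have hβ1 : β ≤ 1 := (hβα 0).trans (hα 0)
  suffices hinv : β * ∑ k ∈ Finset.range (T + 1), ‖expAverage α u k‖ ^ 2 +
      (1 - β) * ‖expAverage α u T‖ ^ 2 ≤ σ ^ 2 +
      σ ^ 2 * ∑ k ∈ Finset.range (T + 1), α k ^ 2 +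
      ∑ k ∈ Finset.range (T + 1), inner ℝ (averageWeight α u k) (u k) from
    (le_add_of_nonneg_right (mul_nonneg (sub_nonneg.2 hβ1) (sq_nonneg _))).trans hinv
  induction T with
  | zero =>
    have hu0 : ‖u 0‖ ^ 2 ≤ σ ^ 2 := pow_le_pow_left₀ (norm_nonneg _) (hu 0 zero_lt_one) 2
    simp only [zero_add, Finset.sum_range_one, expAverage, averageWeight, inner_zero_left]
    linarith [mul_nonneg (sq_nonneg σ) (sq_nonneg (α 0))]
  | succ T ih =>
    have hstep := sq_norm_expAverage_succ_le hβ (hβα _) (hα _) (hu (T + 1) (Nat.lt_succ_self _))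
    rw [Finset.sum_range_succ (fun k => ‖expAverage α u k‖ ^ 2) (T + 1),
      Finset.sum_range_succ (fun k => α k ^ 2) (T + 1),
      Finset.sum_range_succ (fun k => inner ℝ (averageWeight α u k) (u k)) (T + 1)]
    linarith [ih fun k hk => hu k (hk.trans (Nat.lt_succ_self _))]


variable {Ω : Type*} {m₀ : MeasurableSpace Ω} {μ : Measure Ω} [IsProbabilityMeasure μ]
  [CompleteSpace E] {𝓕 : Filtration ℕ m₀} {u : ℕ → Ω → E} {T : ℕ}

theorem measureReal_sum_inner_averageWeight_ge_le (hα : ∀ k, α k ∈ Set.Icc 0 1)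
    (hu : ∀ k < T, StronglyMeasurable[𝓕 (k + 1)] (u k)) (huσ : ∀ k < T, ∀ᵐ ω ∂μ, ‖u k ω‖ ≤ σ)
    (hu0 : ∀ k < T, μ[u k | 𝓕 k] =ᵐ[μ] 0) {V a : ℝ} (hV : 0 < V) (ha : 0 ≤ a)
    (hαV : 4 * σ ^ 4 * ∑ k ∈ Finset.range T, α k ^ 2 ≤ V) :
    μ.real {ω | a ≤ ∑ k ∈ Finset.range T,
      inner ℝ (averageWeight α (fun j => u j ω) k) (u k ω)} ≤ Real.exp (-(a ^ 2 / (2 * V))) := by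
  have hW {k : ℕ} (hk : k < T) :
      StronglyMeasurable[𝓕 k] fun ω => averageWeight α (fun j => u j ω) k :=
    stronglyMeasurable_averageWeight fun j hj => (hu j (hj.trans hk)).mono (𝓕.mono hj)
  have hWu {k : ℕ} (hk : k < T) : StronglyMeasurable[𝓕 (k + 1)] fun ω =>
      (inner ℝ (averageWeight α (fun j => u j ω) k) (u k ω) : ℝ) :=
    ((hW hk).mono (𝓕.mono k.le_succ)).inner (hu k hk)
  have hbound {k : ℕ} (hk : k < T) :
      ∀ᵐ ω ∂μ, |inner ℝ (averageWeight α (fun j => u j ω) k) (u k ω)| ≤ 2 * α k * σ * σ := by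
    have hpast : ∀ᵐ ω ∂μ, ∀ j ≤ k, ‖u j ω‖ ≤ σ :=
      (ae_ball_iff (Set.to_countable (Set.Iic k))).2 fun j hj => huσ j (hj.trans_lt hk)
    filter_upwards [hpast] with ω hω
    have hweight := norm_averageWeight_le hα hω
    exact (abs_real_inner_le_norm _ _).trans
      (mul_le_mul hweight (hω k le_rfl) (norm_nonneg _) ((norm_nonneg _).trans hweight))
  refine measureReal_sum_ge_le_of_condExp_eq_zero (fun k hk => hWu hk) (fun k hk => hbound hk)
    (fun k hk => ?_) hV ha (le_of_eq_of_le ?_ hαV)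
  · have hmeas := ((hu k hk).mono (𝓕.le _)).aestronglyMeasurable (μ := μ)
    exact condExp_inner_eq_zero (hW hk)
      (.of_bound ((hWu hk).mono (𝓕.le _)).aestronglyMeasurable _ (hbound hk))
      (.of_bound hmeas σ (huσ k hk)) (hu0 k hk)
  · rw [Finset.mul_sum]
    exact Finset.sum_congr rfl fun k _ => by ring

theorem measureReal_mul_sum_sq_norm_expAverage_gt_le (hβ : 0 ≤ β) (hβα : ∀ k, β ≤ α k)
    (hα : ∀ k, α k ≤ 1) (hu : ∀ k < T, StronglyMeasurable[𝓕 (k + 1)] (u k))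
    (huσ : ∀ k < T, ∀ᵐ ω ∂μ, ‖u k ω‖ ≤ σ) (hu0 : ∀ k < T, μ[u k | 𝓕 k] =ᵐ[μ] 0) {V a : ℝ}
    (hV : 0 < V) (ha : 0 ≤ a) (hαV : 4 * σ ^ 4 * ∑ k ∈ Finset.range T, α k ^ 2 ≤ V) :
    μ.real {ω | σ ^ 2 + σ ^ 2 * ∑ k ∈ Finset.range T, α k ^ 2 + a <
      β * ∑ k ∈ Finset.range T, ‖expAverage α (fun j => u j ω) k‖ ^ 2} ≤
      Real.exp (-(a ^ 2 / (2 * V))) := by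
  have hbound : ∀ᵐ ω ∂μ, ∀ k < T, ‖u k ω‖ ≤ σ :=
    (ae_ball_iff (Set.to_countable (Set.Iio T))).2 huσ
  refine (ENNReal.toReal_mono (measure_ne_top μ _) (measure_mono_ae ?_)).trans
    (measureReal_sum_inner_averageWeight_ge_le (fun k => ⟨hβ.trans (hβα k), hα k⟩) hu huσ hu0 hV
      ha hαV)
  filter_upwards [hbound] with ω hω hlarge
  have hexpand := mul_sum_sq_norm_expAverage_le hβ hβα hα hω
  exact le_of_lt (lt_of_add_lt_add_left (hlarge.trans_le hexpand))

/-- The mean of `β * ∑ ‖expAverage α u k‖ ^ 2` is of order `σ² β² T`, because `∑ αₖ²` is. The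
Azuma–Hoeffding deviation has order `σ² β √(T ι)`, which `1 ≤ β² T` absorbs. -/
theorem measureReal_sum_sq_norm_expAverage_biasWeight_gt_le (hβ : 0 < β) (hβ1 : β ≤ 1)
    (hT : 1 ≤ β ^ 2 * T) (hσ : 0 ≤ σ) {ι : ℝ} (hι : 1 ≤ ι)
    (hu : ∀ k < T, StronglyMeasurable[𝓕 (k + 1)] (u k)) (huσ : ∀ k < T, ∀ᵐ ω ∂μ, ‖u k ω‖ ≤ σ)
    (hu0 : ∀ k < T, μ[u k | 𝓕 k] =ᵐ[μ] 0) :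
    μ.real {ω | 14 * (σ ^ 2 * β * T * √ι) <
      ∑ k ∈ Finset.range T, ‖expAverage (biasWeight β) (fun j => u j ω) k‖ ^ 2} ≤
      Real.exp (-ι) := by
  rcases hσ.eq_or_lt with rfl | hσpos
  · refine (measureReal_eq_zero_iff (measure_ne_top μ _)).2 (measure_eq_zero_iff_ae_notMem.2 ?_)
      |>.trans_le (Real.exp_nonneg _)
    filter_upwards [(ae_ball_iff (Set.to_countable (Set.Iio T))).2 huσ] with ω hω
    refine fun hlarge =>
      hlarge.not_ge (le_of_eq_of_le (Finset.sum_eq_zero fun k hk => ?_) (by simp))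
    rw [sq_eq_zero_iff, ← norm_le_zero_iff, norm_norm]
    exact norm_expAverage_le (fun k => ⟨hβ.le.trans (le_biasWeight hβ hβ1 k),
      biasWeight_le_one hβ hβ1 k⟩) fun j hj => hω j (hj.trans_lt (Finset.mem_range.1 hk))
  set P := β ^ 2 * T with hP
  have hα := sum_sq_biasWeight_le hβ hβ1 T
  rw [← hP] at hα
  have hsq : P ≤ P * √ι := le_mul_of_one_le_right (by linarith) (Real.one_le_sqrt.2 hι)
  have htail := measureReal_mul_sum_sq_norm_expAverage_gt_le (V := 24 * σ ^ 4 * P)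
    (a := 7 * σ ^ 2 * (P * √ι)) hβ.le (le_biasWeight hβ hβ1) (biasWeight_le_one hβ hβ1) hu huσ
    hu0 (by positivity) (by positivity) ?_
  · refine (measureReal_mono fun ω hω => ?_).trans (htail.trans (Real.exp_le_exp.2 ?_))
    · have hlarge := mul_lt_mul_of_pos_left (Set.mem_ofPred.1 hω) hβ
      have hmean : σ ^ 2 * (1 + ∑ k ∈ Finset.range T, biasWeight β k ^ 2) ≤
          σ ^ 2 * (7 * (P * √ι)) := by
        gcongr
        linarith
      refine lt_of_le_of_lt ?_ hlarge
      rw [show β * (14 * (σ ^ 2 * β * T * √ι)) = 14 * (σ ^ 2 * (P * √ι)) by rw [hP]; ring]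
      linarith
    · rw [neg_le_neg_iff, le_div_iff₀ (by positivity), mul_pow, mul_pow, mul_pow,
        Real.sq_sqrt (by linarith)]
      have hPι : P * (σ ^ 4 * ι) ≤ P ^ 2 * (σ ^ 4 * ι) := by
        gcongr
        exact le_self_pow₀ hT two_ne_zero
      have hnonneg : 0 ≤ P * (σ ^ 4 * ι) := by positivity
      linarith
  · rw [show 24 * σ ^ 4 * P = 4 * σ ^ 4 * (6 * P) by ring]
    gcongr
    linarith

end AveragedNoise

/-! ### The gradient noise of Adam -/

section Noise

theorem measurable_gradient {F : Type*} [NormedAddCommGroup F] [InnerProductSpace ℝ F]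
    [CompleteSpace F] [MeasurableSpace F] [BorelSpace F] (f : F → ℝ) : Measurable (gradient f) :=
  (InnerProductSpace.toDual ℝ F).symm.continuous.measurable.comp (measurable_fderiv ℝ f)

variable {d : ℕ} {Ω : Type u} {Ξ : Type v} [MeasurableSpace Ξ] {g : RVec d → Ξ → RVec d}
  {β β₂ η lam : ℝ} {xinit : RVec d}

theorem measurable_adamState {m : MeasurableSpace Ω} {ξ : ℕ → Ω → Ξ}
    (hg : Measurable (Function.uncurry g)) {k : ℕ} (hξ : ∀ s, 1 ≤ s → s ≤ k → Measurable (ξ s)) :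
    Measurable (fun ω => (adamState g β β₂ η lam xinit (fun s => ξ s ω) k).m) ∧
    Measurable (fun ω => (adamState g β β₂ η lam xinit (fun s => ξ s ω) k).v) ∧
    Measurable (fun ω => (adamState g β β₂ η lam xinit (fun s => ξ s ω) k).x) := by
  induction k with
  | zero => exact ⟨measurable_const, measurable_const, measurable_const⟩
  | succ k ih =>
    obtain ⟨hm, hv, hx⟩ := ih fun s hs hsk => hξ s hs (hsk.trans k.le_succ)
    have hgrad : Measurable fun ω => g (adamState g β β₂ η lam xinit (fun s => ξ s ω) k).x
        (ξ (k + 1) ω) := hg.comp (hx.prodMk (hξ (k + 1) k.succ_pos le_rfl))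
    have hcoord {w : Ω → RVec d} (hw : Measurable w) (i : Fin d) : Measurable fun ω => w ω i :=
      (EuclideanSpace.proj (𝕜 := ℝ) i).continuous.measurable.comp hw
    have htoLp {w : Ω → Fin d → ℝ} (hw : ∀ i, Measurable fun ω => w ω i) :
        Measurable fun ω => (WithLp.toLp 2 (w ω) : RVec d) :=
      (WithLp.measurable_toLp 2 _).comp (measurable_pi_lambda _ hw)
    have hm' (i : Fin d) := ((hcoord hm i).const_mul (1 - β)).add ((hcoord hgrad i).const_mul β)
    have hv' (i : Fin d) := ((hcoord hv i).const_mul (1 - β₂)).add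
      (((hcoord hgrad i).pow_const 2).const_mul β₂)
    exact ⟨htoLp hm', htoLp hv', htoLp fun i => (hcoord hx i).sub
      ((((hv' i).div_const _).sqrt.add_const _).const_div _ |>.mul ((hm' i).div_const _))⟩

/-- The filtration of the samples: at time `k` the samples `ξ 1, …, ξ k` are known. -/
def sampleFiltration {m₀ : MeasurableSpace Ω} (ξ : ℕ → Ω → Ξ) (hξ : ∀ t, Measurable (ξ t)) :
    Filtration ℕ m₀ where
  seq k := samplesBefore ξ (k + 1)
  mono' _ _ hij := iSup₂_le fun s hs => le_iSup₂_of_le s ⟨hs.1, by omega⟩ le_rfl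
  le' _ := iSup₂_le fun s _ => (hξ s).comap_le

theorem measurable_sampleFiltration {m₀ : MeasurableSpace Ω} {ξ : ℕ → Ω → Ξ}
    (hξ : ∀ t, Measurable (ξ t)) {s k : ℕ} (hs : 1 ≤ s) (hsk : s ≤ k) :
    Measurable[sampleFiltration ξ hξ k] (ξ s) :=
  measurable_iff_comap_le.2 (le_iSup₂_of_le (f := fun s (_ : 1 ≤ s ∧ s < k + 1) =>
    MeasurableSpace.comap (ξ s) inferInstance) s ⟨hs, by omega⟩ le_rfl)

/-- The gradient noise `g_t - ∇f(x_t)` of Adam with equal momentum parameters along the samples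
`z`, with the time `t = k + 1` counted from `k = 0`. -/
noncomputable def adamNoise {Ξ : Type v} (f : RVec d → ℝ) (g : RVec d → Ξ → RVec d) (β η lam : ℝ)
    (xinit : RVec d) (z : ℕ → Ξ) (k : ℕ) : RVec d :=
  g (adamIter g β β η lam xinit z (k + 1)) (z (k + 1)) -
    gradient f (adamIter g β β η lam xinit z (k + 1))

variable {m₀ : MeasurableSpace Ω} {ξ : ℕ → Ω → Ξ} {f : RVec d → ℝ}

theorem stronglyMeasurable_adamNoise (hg : Measurable (Function.uncurry g))
    (hξ : ∀ t, Measurable (ξ t)) (k : ℕ) : StronglyMeasurable[sampleFiltration ξ hξ (k + 1)]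
      fun ω => adamNoise f g β η lam xinit (fun s => ξ s ω) k := by
  have hiter : Measurable[sampleFiltration ξ hξ (k + 1)] fun ω =>
      adamIter g β β η lam xinit (fun s => ξ s ω) (k + 1) :=
    (measurable_adamState (m := sampleFiltration ξ hξ (k + 1)) hg fun s hs hsk =>
      measurable_sampleFiltration hξ hs (hsk.trans k.le_succ)).2.2
  exact ((hg.comp (hiter.prodMk (measurable_sampleFiltration hξ k.succ_pos le_rfl))).sub
    ((measurable_gradient f).comp hiter)).stronglyMeasurable

theorem exp_neg_logFactor_le {δ : ℝ} (hδ : 0 < δ) : Real.exp (-logFactor δ) ≤ δ := by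
  have hlog : Real.log (1 / δ) ≤ logFactor δ := le_max_right _ _
  rw [one_div, Real.log_inv] at hlog
  calc Real.exp (-logFactor δ) ≤ Real.exp (Real.log δ) := Real.exp_le_exp.2 (by linarith)
    _ = δ := Real.exp_log hδ

theorem measureReal_sum_sq_norm_expAverage_adamNoise_gt_le {μ : Measure Ω}
    [IsProbabilityMeasure μ] {σ δ : ℝ} {T : ℕ} (hβ : 0 < β) (hβ1 : β ≤ 1) (hT : 1 ≤ β ^ 2 * T)
    (hσ : 0 ≤ σ) (hδ : 0 < δ) (hg : Measurable (Function.uncurry g)) (hξ : ∀ t, Measurable (ξ t))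
    (hnoise : CenteredBoundedNoise μ f g ξ
      (fun t ω => adamIter g β β η lam xinit (fun s => ξ s ω) t) σ T) :
    μ.real {ω | 14 * (σ ^ 2 * β * T * √(logFactor δ)) <
      ∑ k ∈ Finset.range T, ‖expAverage (biasWeight β)
        (adamNoise f g β η lam xinit fun s => ξ s ω) k‖ ^ 2} ≤ δ :=
  (measureReal_sum_sq_norm_expAverage_biasWeight_gt_le (𝓕 := sampleFiltration ξ hξ) hβ hβ1 hT hσ
    (le_max_left _ _) (fun k _ => stronglyMeasurable_adamNoise hg hξ k)
    (fun k hk => (hnoise (k + 1) k.succ_pos hk).2)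
    fun k hk => (hnoise (k + 1) k.succ_pos hk).1).trans (exp_neg_logFactor_le hδ)

theorem ofReal_one_sub_le_measure {μ : Measure Ω} [IsProbabilityMeasure μ] {good bad : Set Ω}
    {δ : ℝ} (hgood : ∀ᵐ ω ∂μ, ω ∉ bad → ω ∈ good) (hbad : μ.real bad ≤ δ) :
    ENNReal.ofReal (1 - δ) ≤ μ good := by
  have hcover : ∀ᵐ ω ∂μ, ω ∈ good ∪ bad := by
    filter_upwards [hgood] with ω hω using or_iff_not_imp_right.2 hω
  have hunion : 1 ≤ μ.real good + μ.real bad := calc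
    1 = μ.real (good ∪ bad) := 
      ((measureReal_congr (Filter.eventuallyEq_univ.2 hcover)).trans probReal_univ).symm
    _ ≤ μ.real good + μ.real bad := measureReal_union_le good bad
  exact (ENNReal.ofReal_le_ofReal (by linarith)).trans_eq ofReal_measureReal

end Noise

/-! ### Consequences of the parameter choice -/

section ParameterChoice

theorem ofReal_rate_le_iff {β a b : ℝ} (ha : 0 < a) (hb : 0 ≤ b) :
    ENNReal.ofReal β ≤ min 1 (extDiv a b) ↔ β ≤ 1 ∧ β * b ≤ a := by
  rw [le_min_iff, ENNReal.ofReal_le_one, ofReal_le_extDiv_iff ha hb]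

theorem ofReal_step_le_iff {η c s a₁ b₁ a₂ b₂ : ℝ} {r : ℝ≥0∞} (hc : 0 < c) (hr : r ≠ 0)
    (hs : 0 ≤ s) (ha₁ : 0 < a₁) (hb₁ : 0 ≤ b₁) (ha₂ : 0 < a₂) (hb₂ : 0 ≤ b₂) :
    ENNReal.ofReal η ≤
        ENNReal.ofReal c * min (r / ENNReal.ofReal s) (min (extDiv a₁ b₁) (extDiv a₂ b₂)) ↔
      ENNReal.ofReal (η / c * s) ≤ r ∧ η * b₁ ≤ c * a₁ ∧ η * b₂ ≤ c * a₂ := by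
  rw [ofReal_le_ofReal_mul_iff hc, le_min_iff, le_min_iff, ofReal_le_div_ofReal_iff hr hs,
    ofReal_le_extDiv_iff ha₁ hb₁, ofReal_le_extDiv_iff ha₂ hb₂, div_mul_eq_mul_div,
    div_mul_eq_mul_div, div_mul_eq_mul_div, div_le_iff₀' hc, div_le_iff₀' hc]

theorem adamHorizon_le {Δ₁ ε C₂ G β η : ℝ} (hβ : 0 < β) (hβ1 : β ≤ 1)
    (hdescent : 0 ≤ C₂ * Δ₁ * G / (η * ε ^ 2)) :
    (adamHorizon Δ₁ ε C₂ G β η : ℝ) ≤ 2 / β ^ 2 + C₂ * Δ₁ * G / (η * ε ^ 2) := by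
  have hone : 1 ≤ 1 / β ^ 2 := (one_le_div (by positivity)).2 (pow_le_one₀ hβ.le hβ1)
  have hmax := max_le_add_of_nonneg (by positivity : 0 ≤ 1 / β ^ 2) hdescent
  calc (adamHorizon Δ₁ ε C₂ G β η : ℝ)
      ≤ max (1 / β ^ 2) (C₂ * Δ₁ * G / (η * ε ^ 2)) + 1 :=
        (Nat.ceil_lt_add_one (by positivity)).le
    _ ≤ 1 / β ^ 2 + C₂ * Δ₁ * G / (η * ε ^ 2) + 1 / β ^ 2 := add_le_add hmax hone
    _ = 2 / β ^ 2 + C₂ * Δ₁ * G / (η * ε ^ 2) := by ring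

theorem one_le_sq_mul_adamHorizon {Δ₁ ε C₂ G β η : ℝ} (hβ : 0 < β) :
    1 ≤ β ^ 2 * adamHorizon Δ₁ ε C₂ G β η := by
  rw [← div_le_iff₀' (by positivity)]
  exact (le_max_left _ _).trans (Nat.le_ceil _)

/-- The numerical constants for which the analysis goes through: `C₁`, `C₂` are large, and `c₁`,
`c₂` are small, `c₁` also relative to `1 / C₂`. -/
structure AreAdamConstants (C₁ C₂ c₁ c₂ : ℝ) : Prop where
  le_C₁ : 7168 ≤ C₁
  le_C₂ : 7168 ≤ C₂
  c₁_pos : 0 < c₁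
  c₁_mul_C₂_le : c₁ * C₂ ≤ 1 / 28672
  c₂_pos : 0 < c₂
  c₂_le : c₂ ≤ 1 / 28672

theorem AreAdamConstants.of_le {C₁ C₂ c₁ c₂ : ℝ} (hC₁ : 7168 ≤ C₁) (hC₂ : 7168 ≤ C₂)
    (hc₁ : 0 < c₁) (hc₁le : c₁ ≤ 1 / (28672 * C₂)) (hc₂ : 0 < c₂)
    (hc₂le : c₂ ≤ 1 / (28672 * C₂)) : AreAdamConstants C₁ C₂ c₁ c₂ where
  le_C₁ := hC₁
  le_C₂ := hC₂
  c₁_pos := hc₁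
  c₁_mul_C₂_le := by rwa [← le_div_iff₀ (by linarith), div_div]
  c₂_pos := hc₂
  c₂_le := hc₂le.trans (one_div_le_one_div_of_le (by norm_num) (by linarith))

namespace AdamChoice

variable {d : ℕ} {ρ L₀ Lρ lam σ ι Δ₁ n₁ ε c₁ c₂ C₁ C₂ G β η T : ℝ}

theorem rate_bounds (h : AdamChoice d ρ L₀ Lρ lam σ ι Δ₁ n₁ ε c₁ c₂ C₁ G β η) (hc₁ : 0 < c₁)
    (hlam : 0 < lam) (hε : 0 < ε) : β ≤ 1 ∧ β * (σ ^ 2 * G * √ι) ≤ c₁ * lam * ε ^ 2 :=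
  have := h.G_pos
  (ofReal_rate_le_iff (by positivity) (by positivity)).1 h.beta_le

theorem step_bounds (h : AdamChoice d ρ L₀ Lρ lam σ ι Δ₁ n₁ ε c₁ c₂ C₁ G β η) (hc₂ : 0 < c₂)
    (hL₀ : 0 ≤ L₀) (hLρ : 0 ≤ Lρ) (hlam : 0 < lam) :
    ENNReal.ofReal (η / c₂ * √d) ≤ localRadius ρ L₀ Lρ G ∧
      η * (√(d * ι) * effSmooth ρ L₀ Lρ G) ≤ c₂ * (lam * β) ∧
      η * (effSmooth ρ L₀ Lρ G * √G) ≤ c₂ * (lam ^ (3 / 2 : ℝ) * β) := by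
  have hβ := h.beta_pos
  have hL : 0 ≤ effSmooth ρ L₀ Lρ G := effSmooth_nonneg hL₀ hLρ h.G_pos.le
  exact (ofReal_step_le_iff hc₂ (localRadius_ne_zero _ _ _ _) (by positivity) (by positivity)
    (by positivity) (by positivity) (by positivity)).1 h.eta_le

theorem mul_effSmooth_mul_gap_le (h : AdamChoice d ρ L₀ Lρ lam σ ι Δ₁ n₁ ε c₁ c₂ C₁ G β η)
    (hC₁ : 0 ≤ C₁) (hρ2 : ρ < 2) (hLρ : 0 ≤ Lρ) (hΔ : 0 ≤ Δ₁) :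
    C₁ * (effSmooth ρ L₀ Lρ G * √d * Δ₁) ≤ 7 * G ^ 2 := by
  have hG := h.G_pos
  have hconst : C₁ * Δ₁ * L₀ * √d ≤ G ^ 2 := (Real.sqrt_le_left hG.le).1 h.G_ge_L0
  have hpow : C₁ * Δ₁ * Lρ * √d * G ^ ρ ≤ G ^ 2 := calc
    C₁ * Δ₁ * Lρ * √d * G ^ ρ ≤ G ^ (2 - ρ) * G ^ ρ := by
        gcongr
        rw [← Real.rpow_inv_le_iff_of_pos (by positivity) hG.le (sub_pos.2 hρ2), ← one_div]
        exact h.G_ge_Lrho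
    _ = G ^ 2 := by rw [← Real.rpow_add hG, sub_add_cancel, Real.rpow_two]
  unfold effSmooth
  linarith

theorem effSmooth_mul_step_le (h : AdamChoice d ρ L₀ Lρ lam σ ι Δ₁ n₁ ε c₁ c₂ C₁ G β η)
    (hc₁ : 0 < c₁) (hc₂ : 0 < c₂) (hc₂le : c₂ ≤ 1 / 2) (hL₀ : 0 ≤ L₀) (hLρ : 0 ≤ Lρ)
    (hlam : 0 < lam) (hε : 0 < ε) (hι : 1 ≤ ι) :
    effSmooth ρ L₀ Lρ G * (η * √d) ≤ G / 4 := by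
  have hβ := h.beta_pos
  have hη := h.eta_pos
  have hL : 0 ≤ effSmooth ρ L₀ Lρ G := effSmooth_nonneg hL₀ hLρ h.G_pos.le
  calc effSmooth ρ L₀ Lρ G * (η * √d) = η * (√d * effSmooth ρ L₀ Lρ G) := by ring
    _ ≤ η * (√(d * ι) * effSmooth ρ L₀ Lρ G) := by
        gcongr
        exact le_mul_of_one_le_right (Nat.cast_nonneg d) hι
    _ ≤ c₂ * (lam * β) := (h.step_bounds hc₂ hL₀ hLρ hlam).2.1
    _ ≤ 1 / 2 * (lam * 1) := by
        gcongr
        exact (h.rate_bounds hc₁ hlam hε).1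
    _ ≤ G / 4 := by linarith [h.G_ge_lam]

theorem drift_sq_le (h : AdamChoice d ρ L₀ Lρ lam σ ι Δ₁ n₁ ε c₁ c₂ C₁ G β η) (hc₂ : 0 < c₂)
    (hL₀ : 0 ≤ L₀) (hLρ : 0 ≤ Lρ) (hlam : 0 < lam) :
    G * (effSmooth ρ L₀ Lρ G * η / (lam * β)) ^ 2 ≤ c₂ ^ 2 * lam := by
  have hG := h.G_pos
  have hβ := h.beta_pos
  have hη := h.eta_pos
  set L := effSmooth ρ L₀ Lρ G
  have hL : 0 ≤ L := effSmooth_nonneg hL₀ hLρ hG.le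
  have hlampow : lam ^ (3 / 2 : ℝ) = lam * √lam := by
    rw [Real.sqrt_eq_rpow, ← Real.rpow_one_add' hlam.le (by norm_num)]
    norm_num
  have hroot : √G * (L * η / (lam * β)) ≤ c₂ * √lam := by
    rw [← mul_div_assoc, div_le_iff₀ (by positivity)]
    have hstep := (h.step_bounds hc₂ hL₀ hLρ hlam).2.2
    rw [hlampow] at hstep
    linarith
  calc G * (L * η / (lam * β)) ^ 2 = (√G * (L * η / (lam * β))) ^ 2 := by
        rw [mul_pow, Real.sq_sqrt hG.le]
    _ ≤ (c₂ * √lam) ^ 2 := by gcongr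
    _ = c₂ ^ 2 * lam := by rw [mul_pow, Real.sq_sqrt hlam.le]

theorem isAdamRegime (h : AdamChoice d ρ L₀ Lρ lam σ ι Δ₁ n₁ ε c₁ c₂ C₁ G β η)
    (hc : AreAdamConstants C₁ C₂ c₁ c₂) (hL₀ : 0 ≤ L₀) (hLρ : 0 ≤ Lρ) (hlam : 0 < lam)
    (hε : 0 < ε) : IsAdamRegime (biasWeight β) β η lam (effSmooth ρ L₀ Lρ G) G := by
  have hβ1 : β ≤ 1 := (h.rate_bounds hc.c₁_pos hlam hε).1
  have hdrift := h.drift_sq_le hc.c₂_pos hL₀ hLρ hlam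
  have hc₂sq : c₂ ^ 2 ≤ (1 / 28672) ^ 2 := pow_le_pow_left₀ hc.c₂_pos.le hc.c₂_le 2
  set D := effSmooth ρ L₀ Lρ G * η / (lam * β)
  have hdriftlam : lam * D ^ 2 ≤ lam * (1 / 28672) ^ 2 := calc
    lam * D ^ 2 ≤ G * D ^ 2 := by gcongr; linarith [h.G_ge_lam]
    _ ≤ c₂ ^ 2 * lam := hdrift
    _ ≤ lam * (1 / 28672) ^ 2 := by rw [mul_comm]; gcongr
  have hD : D ≤ 1 / 28672 :=
    le_of_sq_le_sq (le_of_mul_le_mul_left hdriftlam hlam) (by norm_num)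
  exact
    { rate_pos := h.beta_pos
      rate_le_weight := le_biasWeight h.beta_pos hβ1
      weight_le_one := biasWeight_le_one h.beta_pos hβ1
      step_pos := h.eta_pos
      reg_pos := hlam
      two_mul_reg_le := h.G_ge_lam
      smooth_nonneg := effSmooth_nonneg hL₀ hLρ h.G_pos.le
      drift_le := hD.trans (by norm_num)
      drift_sq_le := by nlinarith }

theorem descent_budget (h : AdamChoice d ρ L₀ Lρ lam σ ι Δ₁ n₁ ε c₁ c₂ C₁ G β η)
    (hC₁ : 7168 ≤ C₁) (hρ2 : ρ < 2) (hL₀ : 0 ≤ L₀) (hLρ : 0 ≤ Lρ) (hΔ : 0 ≤ Δ₁) :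
    16 * (effSmooth ρ L₀ Lρ G * (η * √d)) * (16 * G / η * Δ₁) ≤ G ^ 3 / 4 := by
  have hG := h.G_pos
  have hη := h.eta_pos
  have hL : 0 ≤ effSmooth ρ L₀ Lρ G := effSmooth_nonneg hL₀ hLρ hG.le
  calc 16 * (effSmooth ρ L₀ Lρ G * (η * √d)) * (16 * G / η * Δ₁)
      = G / 28 * (7168 * (effSmooth ρ L₀ Lρ G * √d * Δ₁)) := by field_simp; ring
    _ ≤ G / 28 * (C₁ * (effSmooth ρ L₀ Lρ G * √d * Δ₁)) := by gcongr
    _ ≤ G / 28 * (7 * G ^ 2) := by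
        gcongr G / 28 * ?_
        exact h.mul_effSmooth_mul_gap_le (by linarith) hρ2 hLρ hΔ
    _ = G ^ 3 / 4 := by ring

theorem startup_noise_budget (h : AdamChoice d ρ L₀ Lρ lam σ ι Δ₁ n₁ ε c₁ c₂ C₁ G β η)
    (hc₂ : 0 < c₂) (hc₂le : c₂ ≤ 1 / 28672) (hL₀ : 0 ≤ L₀) (hLρ : 0 ≤ Lρ) (hlam : 0 < lam)
    (hσ : 0 ≤ σ) :
    16 * (effSmooth ρ L₀ Lρ G * (η * √d)) *
      (64 * G / lam * (14 * (σ ^ 2 * β * (2 / β ^ 2) * √ι))) ≤ G ^ 3 / 4 := by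
  have hG := h.G_pos
  have hβ := h.beta_pos
  have hη := h.eta_pos
  set L := effSmooth ρ L₀ Lρ G
  have hL : 0 ≤ L := effSmooth_nonneg hL₀ hLρ hG.le
  have hstep : η * (√d * √ι * L) ≤ 1 / 28672 * (lam * β) := by
    rw [← Real.sqrt_mul (Nat.cast_nonneg d)]
    exact (h.step_bounds hc₂ hL₀ hLρ hlam).2.1.trans (by gcongr)
  calc 16 * (L * (η * √d)) * (64 * G / lam * (14 * (σ ^ 2 * β * (2 / β ^ 2) * √ι)))
      = 7168 * (2 * σ) ^ 2 * G / (lam * β) * (η * (√d * √ι * L)) := by field_simp; ring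
    _ ≤ 7168 * G ^ 2 * G / (lam * β) * (1 / 28672 * (lam * β)) := by
        gcongr
        exact h.G_ge_sigma
    _ = G ^ 3 / 4 := by field_simp; ring

theorem horizon_noise_budget (h : AdamChoice d ρ L₀ Lρ lam σ ι Δ₁ n₁ ε c₁ c₂ C₁ G β η)
    (hc : AreAdamConstants C₁ C₂ c₁ c₂) (hρ2 : ρ < 2) (hL₀ : 0 ≤ L₀) (hLρ : 0 ≤ Lρ)
    (hlam : 0 < lam) (hε : 0 < ε) (hΔ : 0 ≤ Δ₁) :
    16 * (effSmooth ρ L₀ Lρ G * (η * √d)) *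
      (64 * G / lam * (14 * (σ ^ 2 * β * (C₂ * Δ₁ * G / (η * ε ^ 2)) * √ι))) ≤ G ^ 3 / 4 := by
  have hG := h.G_pos
  have hβ := h.beta_pos
  have hη := h.eta_pos
  have hC₂ : 0 < C₂ := by linarith [hc.le_C₂]
  have hc₁ := hc.c₁_pos
  have hC₁ : 0 ≤ C₁ := by linarith [hc.le_C₁]
  have hgap := h.mul_effSmooth_mul_gap_le hC₁ hρ2 hLρ hΔ
  have hrate := (h.rate_bounds hc₁ hlam hε).2
  set L := effSmooth ρ L₀ Lρ G
  have hL : 0 ≤ L := effSmooth_nonneg hL₀ hLρ hG.le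
  calc 16 * (L * (η * √d)) * (64 * G / lam * (14 * (σ ^ 2 * β * (C₂ * Δ₁ * G / (η * ε ^ 2)) * √ι)))
      = 2 * C₂ * G / (lam * ε ^ 2) * (7168 * (L * √d * Δ₁)) * (β * (σ ^ 2 * G * √ι)) := by
        field_simp; ring
    _ ≤ 2 * C₂ * G / (lam * ε ^ 2) * (C₁ * (L * √d * Δ₁)) * (c₁ * lam * ε ^ 2) := by
        gcongr
        exact hc.le_C₁
    _ ≤ 2 * C₂ * G / (lam * ε ^ 2) * (7 * G ^ 2) * (c₁ * lam * ε ^ 2) := by gcongr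
    _ = 14 * G ^ 3 * (c₁ * C₂) := by field_simp; ring
    _ ≤ 14 * G ^ 3 * (1 / 28672) := by gcongr; exact hc.c₁_mul_C₂_le
    _ ≤ G ^ 3 / 4 := by linarith [pow_pos hG 3]

theorem gradient_budget (h : AdamChoice d ρ L₀ Lρ lam σ ι Δ₁ n₁ ε c₁ c₂ C₁ G β η)
    (hc : AreAdamConstants C₁ C₂ c₁ c₂) (hρ2 : ρ < 2) (hL₀ : 0 ≤ L₀) (hLρ : 0 ≤ Lρ)
    (hlam : 0 < lam) (hσ : 0 ≤ σ) (hε : 0 < ε) (hΔ : 0 ≤ Δ₁)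
    (hT : T ≤ 2 / β ^ 2 + C₂ * Δ₁ * G / (η * ε ^ 2)) :
    16 * (effSmooth ρ L₀ Lρ G * (η * √d)) *
      (16 * G / η * Δ₁ + 64 * G / lam * (14 * (σ ^ 2 * β * T * √ι))) ≤ G ^ 3 := by
  have hG := h.G_pos
  have hβ := h.beta_pos
  have hη := h.eta_pos
  have hdescent := h.descent_budget hc.le_C₁ hρ2 hL₀ hLρ hΔ
  have hstartup := h.startup_noise_budget hc.c₂_pos hc.c₂_le hL₀ hLρ hlam hσ
  have hhorizon := h.horizon_noise_budget hc hρ2 hL₀ hLρ hlam hε hΔ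
  set L := effSmooth ρ L₀ Lρ G
  have hL : 0 ≤ L := effSmooth_nonneg hL₀ hLρ hG.le
  calc 16 * (L * (η * √d)) * (16 * G / η * Δ₁ + 64 * G / lam * (14 * (σ ^ 2 * β * T * √ι)))
      ≤ 16 * (L * (η * √d)) * (16 * G / η * Δ₁ + 64 * G / lam *
          (14 * (σ ^ 2 * β * (2 / β ^ 2 + C₂ * Δ₁ * G / (η * ε ^ 2)) * √ι))) := by gcongr
    _ ≤ 3 * (G ^ 3 / 4) := by linarith
    _ ≤ G ^ 3 := by linarith [pow_pos hG 3]

theorem average_budget (h : AdamChoice d ρ L₀ Lρ lam σ ι Δ₁ n₁ ε c₁ c₂ C₁ G β η)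
    (hc : AreAdamConstants C₁ C₂ c₁ c₂) (hlam : 0 < lam) (hε : 0 < ε) (hΔ : 0 ≤ Δ₁)
    (hT0 : 0 ≤ T) (hT : C₂ * Δ₁ * G / (η * ε ^ 2) ≤ T) :
    16 * G / η * Δ₁ + 64 * G / lam * (14 * (σ ^ 2 * β * T * √ι)) ≤ ε ^ 2 * T := by
  have hG := h.G_pos
  have hη := h.eta_pos
  have hdescent : 16 * G / η * Δ₁ ≤ ε ^ 2 * T / 2 := calc
    16 * G / η * Δ₁ = 32 * Δ₁ * G / (η * ε ^ 2) * (ε ^ 2 / 2) := by field_simp; ring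
    _ ≤ C₂ * Δ₁ * G / (η * ε ^ 2) * (ε ^ 2 / 2) := by
        gcongr
        linarith [hc.le_C₂]
    _ ≤ T * (ε ^ 2 / 2) := by gcongr
    _ = ε ^ 2 * T / 2 := by ring
  have hc₁ : c₁ ≤ 1 / 1792 := by
    nlinarith [hc.c₁_mul_C₂_le, hc.le_C₂, hc.c₁_pos]
  have hnoise : 64 * G / lam * (14 * (σ ^ 2 * β * T * √ι)) ≤ ε ^ 2 * T / 2 := calc
    64 * G / lam * (14 * (σ ^ 2 * β * T * √ι)) = 896 * T / lam * (β * (σ ^ 2 * G * √ι)) := by ring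
    _ ≤ 896 * T / lam * (1 / 1792 * lam * ε ^ 2) := by
        gcongr _ * ?_
        exact (h.rate_bounds hc.c₁_pos hlam hε).2.trans (by gcongr)
    _ = ε ^ 2 * T / 2 := by field_simp; ring
  linarith

end AdamChoice

end ParameterChoice

/-! ### Convergence -/

section Convergence

theorem initialGap_nonneg {d : ℕ} {U : Set (RVec d)} {f : RVec d → ℝ} {x : RVec d} (hx : x ∈ U)
    (hf : BddBelow (f '' U)) : 0 ≤ initialGap U f x :=
  sub_nonneg.2 (csInf_le hf ⟨x, hx, rfl⟩)

theorem sub_le_initialGap {d : ℕ} {U : Set (RVec d)} {f : RVec d → ℝ} {x y : RVec d} (hy : y ∈ U)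
    (hf : BddBelow (f '' U)) : f x - f y ≤ initialGap U f x :=
  sub_le_sub_left (csInf_le hf ⟨y, hy, rfl⟩) _

theorem IsSmoothObjective.isSmoothStep {d : ℕ} {U : Set (RVec d)} {f : RVec d → ℝ}
    {ρ L₀ Lρ G : ℝ} (hf : IsSmoothObjective U f ρ L₀ Lρ) (hG : 0 < G) {y : ℕ → RVec d} {k : ℕ}
    (hseg : segment ℝ (y k) (y (k + 1)) ⊆ U) (hy : ‖gradient f (y k)‖ ≤ G)
    (hshort : ENNReal.ofReal (2 * ‖y (k + 1) - y k‖) ≤ localRadius ρ L₀ Lρ G) :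
    IsSmoothStep (effSmooth ρ L₀ Lρ G) (fun k => f (y k)) (fun k => gradient f (y k)) y k where
  norm_sub_le := hf.norm_gradient_sub_le hG hseg hy hshort
  sub_le := hf.sub_le_inner_gradient_add hG hseg hy hshort

variable {C₁ C₂ c₁ c₂ : ℝ} {d : ℕ} {U : Set (RVec d)} {f : RVec d → ℝ} {ρ L₀ Lρ σ : ℝ}
  {Ξ : Type v} {g : RVec d → Ξ → RVec d} {xinit : RVec d} {ε lam G β η : ℝ}

theorem forall_norm_gradient_adamIter_le_and_sum_sq_le {z : ℕ → Ξ} {ι : ℝ} {T : ℕ}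
    (hc : AreAdamConstants C₁ C₂ c₁ c₂) (hf : IsSmoothObjective U f ρ L₀ Lρ) (hx : xinit ∈ U)
    (hσ : 0 ≤ σ) (hε : 0 < ε) (hlam : 0 < lam) (hι : 1 ≤ ι)
    (hch : AdamChoice d ρ L₀ Lρ lam σ ι (initialGap U f xinit) ‖gradient f xinit‖ ε
      c₁ c₂ C₁ G β η)
    (hT : T ≤ 2 / β ^ 2 + C₂ * initialGap U f xinit * G / (η * ε ^ 2))
    (hseg : ∀ k < T, segment ℝ (adamIter g β β η lam xinit z (k + 1))
      (adamIter g β β η lam xinit z (k + 2)) ⊆ U)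
    (hnoise : ∀ k < T, ‖adamNoise f g β η lam xinit z k‖ ≤ σ)
    (hQ : ∑ k ∈ Finset.range T, ‖expAverage (biasWeight β) (adamNoise f g β η lam xinit z) k‖ ^ 2 ≤
      14 * (σ ^ 2 * β * T * √ι)) :
    (∀ k ≤ T, ‖gradient f (adamIter g β β η lam xinit z (k + 1))‖ ≤ G) ∧
      ∑ k ∈ Finset.range T, ‖gradient f (adamIter g β β η lam xinit z (k + 1))‖ ^ 2 ≤
        16 * G / η * initialGap U f xinit + 64 * G / lam * (14 * (σ ^ 2 * β * T * √ι)) := by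
  have hr := hch.isAdamRegime hc hf.L₀_nonneg hf.Lρ_nonneg hlam hε
  have hβ1 := (hch.rate_bounds hc.c₁_pos hlam hε).1
  set y : ℕ → RVec d := fun k => adamIter g β β η lam xinit z (k + 1) with hy
  have htraj : IsAdamTrajectory (biasWeight β) η lam
      (fun k => gradient f (y k) + adamNoise f g β η lam xinit z k) y := by
    simpa only [adamNoise, hy, add_sub_cancel] using isAdamTrajectory_adamIter hch.beta_pos hβ1
  have hyU (k : ℕ) (hk : k ≤ T) : y k ∈ U := by
    cases k with
    | zero => exact hx
    | succ k => exact hseg k hk (right_mem_segment ℝ _ _)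
  have hshort (k : ℕ) : ENNReal.ofReal (2 * ‖y (k + 1) - y k‖) ≤ localRadius ρ L₀ Lρ G := by
    refine (ENNReal.ofReal_le_ofReal ?_).trans
      (hch.step_bounds hc.c₂_pos hf.L₀_nonneg hf.Lρ_nonneg hlam).1
    have hc₂inv : 2 ≤ 1 / c₂ := (le_div_iff₀ hc.c₂_pos).2 (by linarith [hc.c₂_le])
    calc 2 * ‖y (k + 1) - y k‖ ≤ 1 / c₂ * (η * √d) := by
          gcongr
          exact htraj.norm_step_le hr.weight_mem hr.step_pos.le hlam k
      _ = η / c₂ * √d := by ring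
  exact htraj.forall_norm_le_and_sum_sq_norm_le (F := fun k => f (y k)) hr
    (hch.effSmooth_mul_step_le hc.c₁_pos hc.c₂_pos (hc.c₂_le.trans (by norm_num)) hf.L₀_nonneg
      hf.Lρ_nonneg hlam hε hι)
    (fun k hk => (hnoise k hk).trans (by linarith [hch.G_ge_sigma])) hch.G_ge_grad
    (fun k hk hyk => hf.isSmoothStep hch.G_pos (hseg k hk) hyk (hshort k))
    (fun k hk => sub_le_initialGap (hyU k hk) hf.bddBelow) hQ
    (hch.gradient_budget hc hf.exponent_lt_two hf.L₀_nonneg hf.Lρ_nonneg hlam hσ hε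
      (initialGap_nonneg hx hf.bddBelow) hT)

theorem adam_path_converges {z : ℕ → Ξ} {ι : ℝ} {T : ℕ} (hc : AreAdamConstants C₁ C₂ c₁ c₂)
    (hf : IsSmoothObjective U f ρ L₀ Lρ) (hx : xinit ∈ U) (hσ : 0 ≤ σ) (hε : 0 < ε)
    (hlam : 0 < lam) (hι : 1 ≤ ι)
    (hch : AdamChoice d ρ L₀ Lρ lam σ ι (initialGap U f xinit) ‖gradient f xinit‖ ε
      c₁ c₂ C₁ G β η)
    (hT : T = adamHorizon (initialGap U f xinit) ε C₂ G β η)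
    (hseg : ∀ t : ℕ, 1 ≤ t → t ≤ T → segment ℝ (adamIter g β β η lam xinit z t)
      (adamIter g β β η lam xinit z (t + 1)) ⊆ U)
    (hnoise : ∀ k < T, ‖adamNoise f g β η lam xinit z k‖ ≤ σ)
    (hQ : ∑ k ∈ Finset.range T, ‖expAverage (biasWeight β) (adamNoise f g β η lam xinit z) k‖ ^ 2 ≤
      14 * (σ ^ 2 * β * T * √ι)) :
    (∀ t : ℕ, 1 ≤ t → t ≤ T → ‖gradient f (adamIter g β β η lam xinit z t)‖ ≤ G) ∧
      1 / (T : ℝ) * ∑ t ∈ Finset.Icc 1 T, ‖gradient f (adamIter g β β η lam xinit z t)‖ ^ 2 ≤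
        ε ^ 2 := by
  have hβ := hch.beta_pos
  have hβ1 := (hch.rate_bounds hc.c₁_pos hlam hε).1
  have hΔ := initialGap_nonneg hx hf.bddBelow
  have hdescent : 0 ≤ C₂ * initialGap U f xinit * G / (η * ε ^ 2) := by
    have := hch.G_pos
    have := hch.eta_pos
    have : 0 ≤ C₂ := by linarith [hc.le_C₂]
    positivity
  have hTdescent : C₂ * initialGap U f xinit * G / (η * ε ^ 2) ≤ T := by
    rw [hT]
    exact (le_max_right _ _).trans (Nat.le_ceil _)
  have hTpos : (0 : ℝ) < T :=
    pos_of_mul_pos_right (one_pos.trans_le (hT ▸ one_le_sq_mul_adamHorizon hβ)) (sq_nonneg β)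
  obtain ⟨hgrad, hsum⟩ := forall_norm_gradient_adamIter_le_and_sum_sq_le hc hf hx hσ hε hlam hι
    hch (hT ▸ adamHorizon_le hβ hβ1 hdescent) (fun k hk => hseg (k + 1) k.succ_pos hk) hnoise hQ
  refine ⟨fun t ht htT => ?_, ?_⟩
  · simpa only [Nat.sub_add_cancel ht] using hgrad (t - 1) ((Nat.sub_le t 1).trans htT)
  · rw [Finset.range_eq_Ico, Finset.sum_Ico_add'
      (fun t => ‖gradient f (adamIter g β β η lam xinit z t)‖ ^ 2) 0 T 1, zero_add,
      Finset.Ico_add_one_right_eq_Icc] at hsum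
    rw [one_div, inv_mul_le_iff₀ hTpos, mul_comm]
    exact hsum.trans (hch.average_budget hc hlam hε hΔ hTpos.le hTdescent)

theorem adam_convergence {Ω : Type u} [MeasurableSpace Ω] [MeasurableSpace Ξ] {μ : Measure Ω}
    [IsProbabilityMeasure μ] {ξ : ℕ → Ω → Ξ} {δ : ℝ} {T : ℕ} (hc : AreAdamConstants C₁ C₂ c₁ c₂)
    (hf : IsSmoothObjective U f ρ L₀ Lρ) (hx : xinit ∈ U) (hσ : 0 ≤ σ) (hδ : 0 < δ) (hε : 0 < ε)
    (hlam : 0 < lam) (hg : Measurable (Function.uncurry g)) (hξ : ∀ t, Measurable (ξ t))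
    (hch : AdamChoice d ρ L₀ Lρ lam σ (logFactor δ) (initialGap U f xinit) ‖gradient f xinit‖ ε
      c₁ c₂ C₁ G β η)
    (hT : T = adamHorizon (initialGap U f xinit) ε C₂ G β η)
    (hnoise : CenteredBoundedNoise μ f g ξ
      (fun t ω => adamIter g β β η lam xinit (fun s => ξ s ω) t) σ T)
    (hseg : ∀ᵐ ω ∂μ, ∀ t : ℕ, 1 ≤ t → t ≤ T →
      segment ℝ (adamIter g β β η lam xinit (fun s => ξ s ω) t)
        (adamIter g β β η lam xinit (fun s => ξ s ω) (t + 1)) ⊆ U) :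
    ENNReal.ofReal (1 - δ) ≤
      μ {ω | (∀ t : ℕ, 1 ≤ t → t ≤ T →
            ‖gradient f (adamIter g β β η lam xinit (fun s => ξ s ω) t)‖ ≤ G) ∧
          1 / (T : ℝ) * ∑ t ∈ Finset.Icc 1 T,
            ‖gradient f (adamIter g β β η lam xinit (fun s => ξ s ω) t)‖ ^ 2 ≤ ε ^ 2} := by
  have hβ1 := (hch.rate_bounds hc.c₁_pos hlam hε).1
  have hbounded : ∀ᵐ ω ∂μ, ∀ k < T, ‖adamNoise f g β η lam xinit (fun s => ξ s ω) k‖ ≤ σ :=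
    (ae_ball_iff (Set.to_countable (Set.Iio T))).2 fun k hk => (hnoise (k + 1) k.succ_pos hk).2
  refine ofReal_one_sub_le_measure ?_ (measureReal_sum_sq_norm_expAverage_adamNoise_gt_le
    hch.beta_pos hβ1 (hT ▸ one_le_sq_mul_adamHorizon hch.beta_pos) hσ hδ hg hξ hnoise)
  filter_upwards [hseg, hbounded] with ω hsegω hboundedω hgood
  exact adam_path_converges hc hf hx hσ hε hlam (le_max_left _ _) hch hT hsegω hboundedω
    (not_lt.1 hgood)

end Convergence

/-! ### Gradient complexity -/

section Complexity

theorem effSmooth_mul_le {ρ L₀ Lρ γ G : ℝ} (hρ : 0 ≤ ρ) (hL₀ : 0 ≤ L₀) (hγ : 1 ≤ γ) (hG : 0 ≤ G) :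
    effSmooth ρ L₀ Lρ (γ * G) ≤ γ ^ ρ * effSmooth ρ L₀ Lρ G := by
  have hγρ : 3 * L₀ ≤ γ ^ ρ * (3 * L₀) :=
    le_mul_of_one_le_left (by positivity) (Real.one_le_rpow hγ hρ)
  rw [effSmooth, effSmooth, Real.mul_rpow (zero_le_one.trans hγ) hG]
  linarith

theorem ofReal_mul_le_localRadius_mul {ρ L₀ Lρ G γ s w : ℝ} (hL₀ : 0 ≤ L₀) (hLρ : 0 ≤ Lρ)
    (hG : 0 < G) (hγ : 0 < γ) (hw : 0 ≤ w) (hs : s ≤ 1) (hsγ : s * γ ^ (ρ - 1) ≤ 1)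
    (h : ENNReal.ofReal w ≤ localRadius ρ L₀ Lρ G) :
    ENNReal.ofReal (s * w) ≤ localRadius ρ L₀ Lρ (γ * G) := by
  rw [ofReal_le_localRadius_iff hL₀ hLρ hG] at h
  rw [ofReal_le_localRadius_iff hL₀ hLρ (by positivity), Real.mul_rpow hγ.le hG.le]
  refine ⟨?_, fun hρ hL₀' => ?_⟩
  · calc s * w * (5 * Lρ * (γ ^ (ρ - 1) * G ^ (ρ - 1)))
        = s * γ ^ (ρ - 1) * (w * (5 * Lρ * G ^ (ρ - 1))) := by ring
      _ ≤ 1 := mul_le_one₀ hsγ (by positivity) h.1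
  · rw [mul_assoc]
    exact mul_le_one₀ hs (by positivity) (h.2 hρ hL₀')

theorem exists_pos_ofReal_le {x : ℝ≥0∞} (hx : x ≠ 0) : ∃ r : ℝ, 0 < r ∧ ENNReal.ofReal r ≤ x := by
  obtain ⟨r, hr, hrx⟩ := ENNReal.lt_iff_exists_nnreal_btwn.1 (pos_iff_ne_zero.2 hx)
  exact ⟨r, by exact_mod_cast hr, by simpa only [ENNReal.ofReal_coe_nnreal] using hrx.le⟩

theorem extDiv_ne_zero {a : ℝ} (ha : 0 < a) (b : ℝ) : extDiv a b ≠ 0 :=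
  ENNReal.div_ne_zero.2 ⟨(ENNReal.ofReal_pos.2 ha).ne', ENNReal.ofReal_ne_top⟩

theorem exists_adamChoice {lam ε c₁ c₂ : ℝ} (hlam : 0 < lam) (hε : 0 < ε) (hc₁ : 0 < c₁)
    (hc₂ : 0 < c₂) (d : ℕ) (ρ L₀ Lρ σ ι Δ₁ n₁ C₁ : ℝ) :
    ∃ G β η : ℝ, AdamChoice d ρ L₀ Lρ lam σ ι Δ₁ n₁ ε c₁ c₂ C₁ G β η := by
  open Filter in
  obtain ⟨G, hG, hGlam, hGσ, hGn, hGL₀, hGLρ⟩ := ((eventually_gt_atTop 0).and <|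
    (eventually_ge_atTop (2 * lam)).and <| (eventually_ge_atTop (2 * σ)).and <|
    (eventually_ge_atTop (2 * n₁)).and <| (eventually_ge_atTop √(C₁ * Δ₁ * L₀ * √d)).and <|
    eventually_ge_atTop ((C₁ * Δ₁ * Lρ * √d) ^ (1 / (2 - ρ)))).exists
  obtain ⟨β, hβ, hβle⟩ : ∃ β : ℝ, 0 < β ∧
      ENNReal.ofReal β ≤ min 1 (extDiv (c₁ * lam * ε ^ 2) (σ ^ 2 * G * √ι)) :=
    exists_pos_ofReal_le (lt_min one_pos (pos_iff_ne_zero.2 (extDiv_ne_zero (by positivity) _))).ne'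
  obtain ⟨η, hη, hηle⟩ : ∃ η : ℝ, 0 < η ∧ ENNReal.ofReal η ≤ ENNReal.ofReal c₂ *
      min (localRadius ρ L₀ Lρ G / ENNReal.ofReal √d)
        (min (extDiv (lam * β) (√(d * ι) * effSmooth ρ L₀ Lρ G))
          (extDiv (lam ^ (3 / 2 : ℝ) * β) (effSmooth ρ L₀ Lρ G * √G))) := by
    refine exists_pos_ofReal_le (mul_ne_zero (ENNReal.ofReal_pos.2 hc₂).ne' (ne_of_gt ?_))
    exact lt_min (ENNReal.div_pos (localRadius_ne_zero _ _ _ _) ENNReal.ofReal_ne_top)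
      (lt_min (pos_iff_ne_zero.2 (extDiv_ne_zero (by positivity) _))
        (pos_iff_ne_zero.2 (extDiv_ne_zero (by positivity) _)))
  exact ⟨G, β, η, hG, hGlam, hGσ, hGn, hGL₀, hGLρ, hβ, hβle, hη, hηle⟩

namespace AdamChoice

variable {d : ℕ} {ρ L₀ Lρ lam σ ι Δ₁ n₁ ε c₁ c₂ C₁ C₂ G β η γ ζ : ℝ}

theorem scaled_rate_le (h : AdamChoice 1 ρ L₀ Lρ lam σ ι Δ₁ n₁ 1 c₁ c₂ C₁ G β η) (hc₁ : 0 < c₁)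
    (hlam : 0 < lam) (hγ : 1 ≤ γ) (hε : 0 < ε) (hε1 : ε ≤ 1) :
    ENNReal.ofReal (ε ^ 2 * (β / γ)) ≤
      min 1 (extDiv (c₁ * lam * ε ^ 2) (σ ^ 2 * (γ * G) * √ι)) := by
  have hG := h.G_pos
  have hβ := h.beta_pos
  have : 0 < γ := one_pos.trans_le hγ
  obtain ⟨hβ1, hβσ⟩ := h.rate_bounds hc₁ hlam one_pos
  refine (ofReal_rate_le_iff (by positivity) (by positivity)).2 ⟨?_, ?_⟩
  · exact mul_le_one₀ (pow_le_one₀ hε.le hε1) (by positivity) ((div_le_self hβ.le hγ).trans hβ1)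
  · calc ε ^ 2 * (β / γ) * (σ ^ 2 * (γ * G) * √ι) = ε ^ 2 * (β * (σ ^ 2 * G * √ι)) := by
          field_simp
      _ ≤ ε ^ 2 * (c₁ * lam * 1 ^ 2) := by gcongr
      _ = c₁ * lam * ε ^ 2 := by ring

theorem scaled_step_le_localRadius
    (h : AdamChoice 1 ρ L₀ Lρ lam σ ι Δ₁ n₁ 1 c₁ c₂ C₁ G β η) (hc₂ : 0 < c₂) (hρ : 0 ≤ ρ)
    (hL₀ : 0 ≤ L₀) (hLρ : 0 ≤ Lρ) (hlam : 0 < lam) (hγ : 1 ≤ γ) (hd : γ ^ (2 - ρ) = √d)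
    (hζ : 0 ≤ ζ) (hζγ : ζ * γ ^ 3 ≤ 1) (hε : 0 < ε) (hε1 : ε ≤ 1) :
    ENNReal.ofReal (ε ^ 2 * (ζ * η) / c₂ * √d) ≤ localRadius ρ L₀ Lρ (γ * G) := by
  have hη := h.eta_pos
  have hγ0 : 0 < γ := one_pos.trans_le hγ
  have hε2 : ε ^ 2 ≤ 1 := pow_le_one₀ hε.le hε1
  have hpow (a : ℝ) (ha : a ≤ 3) : ζ * γ ^ a ≤ 1 := by
    refine le_trans ?_ hζγ
    rw [← Real.rpow_natCast]
    gcongr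
    exact_mod_cast ha
  have hscale : ε ^ 2 * (ζ * η) / c₂ * √d = ε ^ 2 * (ζ * γ ^ (2 - ρ)) * (η / c₂) := by
    rw [← hd]
    ring
  have hradius := (h.step_bounds hc₂ hL₀ hLρ hlam).1
  rw [Nat.cast_one, Real.sqrt_one, mul_one] at hradius
  rw [hscale]
  refine ofReal_mul_le_localRadius_mul hL₀ hLρ h.G_pos hγ0 (by positivity)
    (mul_le_one₀ hε2 (by positivity) (hpow _ (by linarith))) ?_ hradius
  calc ε ^ 2 * (ζ * γ ^ (2 - ρ)) * γ ^ (ρ - 1) = ε ^ 2 * (ζ * γ ^ (2 - ρ + (ρ - 1))) := by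
        rw [Real.rpow_add hγ0]
        ring
    _ ≤ 1 := mul_le_one₀ hε2 (by positivity) (hpow _ (by linarith))

theorem scaled_step_mul_sqrt_dim_le
    (h : AdamChoice 1 ρ L₀ Lρ lam σ ι Δ₁ n₁ 1 c₁ c₂ C₁ G β η) (hc₂ : 0 < c₂) (hρ : 0 ≤ ρ)
    (hL₀ : 0 ≤ L₀) (hLρ : 0 ≤ Lρ) (hlam : 0 < lam) (hγ : 1 ≤ γ) (hd : γ ^ (2 - ρ) = √d)
    (hζ : 0 ≤ ζ) (hζγ : ζ * γ ^ 3 ≤ 1) :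
    ε ^ 2 * (ζ * η) * (√(d * ι) * effSmooth ρ L₀ Lρ (γ * G)) ≤
      c₂ * (lam * (ε ^ 2 * (β / γ))) := by
  have hη := h.eta_pos
  have hγ0 : 0 < γ := one_pos.trans_le hγ
  have hL : 0 ≤ effSmooth ρ L₀ Lρ G := effSmooth_nonneg hL₀ hLρ h.G_pos.le
  have hstep := (h.step_bounds hc₂ hL₀ hLρ hlam).2.1
  rw [Nat.cast_one, one_mul] at hstep
  have hγsq : γ ^ (2 - ρ) * γ ^ ρ = γ ^ 2 := by
    rw [← Real.rpow_add hγ0, sub_add_cancel, Real.rpow_two]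
  calc ε ^ 2 * (ζ * η) * (√(d * ι) * effSmooth ρ L₀ Lρ (γ * G))
      ≤ ε ^ 2 * (ζ * η) * (γ ^ (2 - ρ) * √ι * (γ ^ ρ * effSmooth ρ L₀ Lρ G)) := by
        rw [Real.sqrt_mul d.cast_nonneg, ← hd]
        gcongr
        exact effSmooth_mul_le hρ hL₀ hγ h.G_pos.le
    _ = ε ^ 2 / γ * (ζ * (γ ^ (2 - ρ) * γ ^ ρ) * γ) * (η * (√ι * effSmooth ρ L₀ Lρ G)) := by
        field_simp
    _ = ε ^ 2 / γ * (ζ * γ ^ 3) * (η * (√ι * effSmooth ρ L₀ Lρ G)) := by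
        rw [hγsq]
        ring
    _ ≤ ε ^ 2 / γ * 1 * (c₂ * (lam * β)) := by gcongr
    _ = c₂ * (lam * (ε ^ 2 * (β / γ))) := by ring

theorem scaled_step_mul_sqrt_gradient_le
    (h : AdamChoice 1 ρ L₀ Lρ lam σ ι Δ₁ n₁ 1 c₁ c₂ C₁ G β η) (hc₂ : 0 < c₂) (hρ : 0 ≤ ρ)
    (hL₀ : 0 ≤ L₀) (hLρ : 0 ≤ Lρ) (hlam : 0 < lam) (hγ : 1 ≤ γ) (hζ : 0 ≤ ζ)
    (hζγ : ζ * γ ^ (ρ + 3 / 2) ≤ 1) :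
    ε ^ 2 * (ζ * η) * (effSmooth ρ L₀ Lρ (γ * G) * √(γ * G)) ≤
      c₂ * (lam ^ (3 / 2 : ℝ) * (ε ^ 2 * (β / γ))) := by
  have hη := h.eta_pos
  have hγ0 : 0 < γ := one_pos.trans_le hγ
  have hL : 0 ≤ effSmooth ρ L₀ Lρ G := effSmooth_nonneg hL₀ hLρ h.G_pos.le
  have hstep := (h.step_bounds hc₂ hL₀ hLρ hlam).2.2
  have hγpow : γ ^ ρ * √γ * γ = γ ^ (ρ + 3 / 2) := by
    rw [Real.sqrt_eq_rpow, ← Real.rpow_add hγ0, ← Real.rpow_add_one hγ0.ne']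
    ring_nf
  calc ε ^ 2 * (ζ * η) * (effSmooth ρ L₀ Lρ (γ * G) * √(γ * G))
      ≤ ε ^ 2 * (ζ * η) * (γ ^ ρ * effSmooth ρ L₀ Lρ G * (√γ * √G)) := by
        rw [Real.sqrt_mul hγ0.le]
        gcongr
        exact effSmooth_mul_le hρ hL₀ hγ h.G_pos.le
    _ = ε ^ 2 / γ * (ζ * (γ ^ ρ * √γ * γ)) * (η * (effSmooth ρ L₀ Lρ G * √G)) := by
        field_simp
    _ ≤ ε ^ 2 / γ * 1 * (c₂ * (lam ^ (3 / 2 : ℝ) * β)) := by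
        rw [hγpow]
        gcongr
    _ = c₂ * (lam ^ (3 / 2 : ℝ) * (ε ^ 2 * (β / γ))) := by ring

theorem scale (h : AdamChoice 1 ρ L₀ Lρ lam σ ι Δ₁ n₁ 1 c₁ c₂ C₁ G β η) (hC₁ : 0 ≤ C₁)
    (hc₁ : 0 < c₁) (hc₂ : 0 < c₂) (hρ : 0 ≤ ρ) (hρ2 : ρ < 2) (hL₀ : 0 ≤ L₀) (hLρ : 0 ≤ Lρ)
    (hlam : 0 < lam) (hΔ : 0 ≤ Δ₁) (hγ : 1 ≤ γ) (hd : γ ^ (2 - ρ) = √d) (hζ : 0 < ζ)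
    (hζγ : ζ * γ ^ 3 ≤ 1) (hζγρ : ζ * γ ^ (ρ + 3 / 2) ≤ 1) (hε : 0 < ε) (hε1 : ε ≤ 1) :
    AdamChoice d ρ L₀ Lρ lam σ ι Δ₁ n₁ ε c₁ c₂ C₁ (γ * G) (ε ^ 2 * (β / γ)) (ε ^ 2 * (ζ * η)) := by
  have hG := h.G_pos
  have hβ := h.beta_pos
  have hη := h.eta_pos
  have hγ0 : 0 < γ := one_pos.trans_le hγ
  have hGγ : G ≤ γ * G := le_mul_of_one_le_left hG.le hγ
  have hsqrt : √√d ≤ γ := by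
    rw [← hd, Real.sqrt_le_left hγ0.le, ← Real.rpow_two]
    exact Real.rpow_le_rpow_of_exponent_le hγ (by linarith)
  have hroot : √d ^ (1 / (2 - ρ)) = γ := by
    rw [← hd, one_div, Real.rpow_rpow_inv hγ0.le (by linarith)]
  have hGL₀ : √(C₁ * Δ₁ * L₀) ≤ G := by simpa using h.G_ge_L0
  have hGLρ : (C₁ * Δ₁ * Lρ) ^ (1 / (2 - ρ)) ≤ G := by simpa using h.G_ge_Lrho
  have hL : 0 ≤ effSmooth ρ L₀ Lρ (γ * G) := effSmooth_nonneg hL₀ hLρ (by positivity)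
  refine ⟨by positivity, h.G_ge_lam.trans hGγ, h.G_ge_sigma.trans hGγ, h.G_ge_grad.trans hGγ,
    ?_, ?_, by positivity, h.scaled_rate_le hc₁ hlam hγ hε hε1, by positivity,
    (ofReal_step_le_iff hc₂ (localRadius_ne_zero _ _ _ _) (by positivity) (by positivity)
      (by positivity) (by positivity) (by positivity)).2
    ⟨h.scaled_step_le_localRadius hc₂ hρ hL₀ hLρ hlam hγ hd hζ.le hζγ hε hε1,
      h.scaled_step_mul_sqrt_dim_le hc₂ hρ hL₀ hLρ hlam hγ hd hζ.le hζγ,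
      h.scaled_step_mul_sqrt_gradient_le hc₂ hρ hL₀ hLρ hlam hγ hζ.le hζγρ⟩⟩
  · rw [Real.sqrt_mul (by positivity), mul_comm]
    exact mul_le_mul hsqrt hGL₀ (Real.sqrt_nonneg _) hγ0.le
  · rw [Real.mul_rpow (by positivity) (Real.sqrt_nonneg _), hroot, mul_comm]
    gcongr

end AdamChoice

theorem adamHorizon_scale_le {C₂ Δ₁ G β η γ ζ ε P : ℝ} (hC₂ : 0 ≤ C₂) (hΔ : 0 ≤ Δ₁) (hG : 0 ≤ G)
    (hβ : 0 < β) (hη : 0 < η) (hγ : 0 < γ) (hζ : 0 < ζ) (hε : 0 < ε)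
    (hrate : ε ^ 2 * (β / γ) ≤ 1) (hγP : γ ^ 2 ≤ P) (hζP : γ / ζ ≤ P) :
    (adamHorizon Δ₁ ε C₂ (γ * G) (ε ^ 2 * (β / γ)) (ε ^ 2 * (ζ * η)) : ℝ) ≤
      (2 / β ^ 2 + C₂ * Δ₁ * G / η) * P / ε ^ 4 := by
  calc (adamHorizon Δ₁ ε C₂ (γ * G) (ε ^ 2 * (β / γ)) (ε ^ 2 * (ζ * η)) : ℝ)
      ≤ 2 / (ε ^ 2 * (β / γ)) ^ 2 + C₂ * Δ₁ * (γ * G) / (ε ^ 2 * (ζ * η) * ε ^ 2) :=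
        adamHorizon_le (by positivity) hrate (by positivity)
    _ = (2 / β ^ 2 * γ ^ 2 + C₂ * Δ₁ * G / η * (γ / ζ)) / ε ^ 4 := by field_simp
    _ ≤ (2 / β ^ 2 * P + C₂ * Δ₁ * G / η * P) / ε ^ 4 := by gcongr
    _ = (2 / β ^ 2 + C₂ * Δ₁ * G / η) * P / ε ^ 4 := by ring

theorem rpow_rpow_two_sub_eq_sqrt {ρ x : ℝ} (hρ : ρ < 2) (hx : 0 ≤ x) :
    (x ^ (1 / (2 * (2 - ρ)))) ^ (2 - ρ) = √x := by
  have : 0 < 2 - ρ := sub_pos.2 hρ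
  rw [← Real.rpow_mul hx, Real.sqrt_eq_rpow]
  congr 1
  field_simp

theorem rpow_max_div_two_sub {ρ x : ℝ} (hρ : ρ < 2) (hx : 0 ≤ x) :
    x ^ max (2 / (2 - ρ)) ((5 + 2 * ρ) / (4 * (2 - ρ))) =
      (x ^ (1 / (2 * (2 - ρ)))) ^ (max 3 (ρ + 3 / 2) + 1) := by
  have : 0 < 2 - ρ := sub_pos.2 hρ
  rw [← Real.rpow_mul hx, max_add, mul_max_of_nonneg _ _ (by positivity)]
  congr 2 <;> · field_simp; ring

/-- With `γ = d^(1 / (2 (2 - ρ)))`, an admissible choice in dimension one for the accuracy one is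
transported by `G ↦ γ G`, `β ↦ ε² β / γ` and `η ↦ ε² η / γ^q`, where `q = max {3, ρ + 3/2}`; the
horizon then grows as `γ^(q + 1) ε⁻⁴`. -/
theorem adam_complexity {C₁ C₂ c₁ c₂ : ℝ} (hc : AreAdamConstants C₁ C₂ c₁ c₂)
    {ρ L₀ Lρ lam σ ι Δ₁ n₁ : ℝ} (hρ : 0 ≤ ρ) (hρ2 : ρ < 2) (hL₀ : 0 ≤ L₀) (hLρ : 0 ≤ Lρ)
    (hlam : 0 < lam) (hΔ : 0 ≤ Δ₁) :
    ∃ K : ℝ, 0 < K ∧ ∀ (d : ℕ) (ε : ℝ), 1 ≤ d → 0 < ε → ε ≤ 1 →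
      ∃ G β η : ℝ, AdamChoice d ρ L₀ Lρ lam σ ι Δ₁ n₁ ε c₁ c₂ C₁ G β η ∧
        (adamHorizon Δ₁ ε C₂ G β η : ℝ) ≤
          K * (d : ℝ) ^ max (2 / (2 - ρ)) ((5 + 2 * ρ) / (4 * (2 - ρ))) / ε ^ 4 := by
  have hC₁ : 0 ≤ C₁ := by linarith [hc.le_C₁]
  have hC₂ : 0 ≤ C₂ := by linarith [hc.le_C₂]
  obtain ⟨G, β, η, h⟩ :=
    exists_adamChoice hlam one_pos hc.c₁_pos hc.c₂_pos 1 ρ L₀ Lρ σ ι Δ₁ n₁ C₁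
  have hG := h.G_pos
  have hβ := h.beta_pos
  have hη := h.eta_pos
  refine ⟨2 / β ^ 2 + C₂ * Δ₁ * G / η, by positivity, fun d ε hd hε hε1 => ?_⟩
  have : 0 < 2 - ρ := sub_pos.2 hρ2
  have hd1 : (1 : ℝ) ≤ d := by exact_mod_cast hd
  set γ : ℝ := (d : ℝ) ^ (1 / (2 * (2 - ρ)))
  have hγ : 1 ≤ γ := Real.one_le_rpow hd1 (by positivity)
  have hγ0 : 0 < γ := one_pos.trans_le hγ
  have hγd : γ ^ (2 - ρ) = √d := rpow_rpow_two_sub_eq_sqrt hρ2 d.cast_nonneg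
  set q : ℝ := max 3 (ρ + 3 / 2)
  have hdim : (d : ℝ) ^ max (2 / (2 - ρ)) ((5 + 2 * ρ) / (4 * (2 - ρ))) = γ ^ (q + 1) :=
    rpow_max_div_two_sub hρ2 d.cast_nonneg
  have hζγ (a : ℝ) (ha : a ≤ q) : γ ^ (-q) * γ ^ a ≤ 1 := by
    rw [← Real.rpow_add hγ0]
    exact Real.rpow_le_one_of_one_le_of_nonpos hγ (by linarith)
  have hscale := h.scale (d := d) (ζ := γ ^ (-q)) hC₁ hc.c₁_pos hc.c₂_pos hρ hρ2 hL₀ hLρ hlam hΔ hγ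
    hγd (by positivity) (by exact_mod_cast hζγ (3 : ℕ) (by exact_mod_cast le_max_left _ _))
    (hζγ _ (le_max_right _ _)) hε hε1
  refine ⟨_, _, _, hscale, ?_⟩
  rw [hdim]
  refine adamHorizon_scale_le hC₂ hΔ hG.le hβ hη hγ0 (by positivity) hε
    (hscale.rate_bounds hc.c₁_pos hlam hε).1 ?_ ?_
  · rw [← Real.rpow_two]
    exact Real.rpow_le_rpow_of_exponent_le hγ (by linarith [le_max_left 3 (ρ + 3 / 2)])
  · rw [Real.rpow_neg hγ0.le, div_inv_eq_mul, mul_comm, Real.rpow_add_one hγ0.ne']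

end Complexity

theorem mainTheorem1 :
    ∃ C₀ : ℝ, 0 < C₀ ∧ ∀ C₁ C₂ : ℝ, C₀ ≤ C₁ → C₀ ≤ C₂ →
    ∃ c₀ : ℝ, 0 < c₀ ∧ ∀ c₁ c₂ : ℝ, 0 < c₁ → c₁ ≤ c₀ → 0 < c₂ → c₂ ≤ c₀ →
    -- convergence with probability at least `1 - δ`
    (∀ (d : ℕ) (U : Set (RVec d)) (f : RVec d → ℝ) (ρ L₀ Lρ σ : ℝ)
        (Ω : Type u) (Ξ : Type v) [MeasurableSpace Ω] [MeasurableSpace Ξ]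
        (μ : Measure Ω) [IsProbabilityMeasure μ]
        (g : RVec d → Ξ → RVec d) (ξ : ℕ → Ω → Ξ) (xinit : RVec d)
        (δ ε lam G β β₂ η : ℝ) (T : ℕ),
        IsOpen U → xinit ∈ U →
        (∀ x ∈ U, DifferentiableAt ℝ f x) → BddBelow (f '' U) →
        0 ≤ ρ → ρ < 2 → 0 ≤ L₀ → 0 ≤ Lρ → IsL0LrhoSmooth U f ρ L₀ Lρ →
        0 ≤ σ → 0 < δ → δ < 1 → 0 < ε → 0 < lam →
        Measurable (Function.uncurry g) → (∀ t, Measurable (ξ t)) →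
        β₂ = β →
        AdamChoice d ρ L₀ Lρ lam σ (logFactor δ) (initialGap U f xinit) ‖gradient f xinit‖ ε
          c₁ c₂ C₁ G β η →
        T = adamHorizon (initialGap U f xinit) ε C₂ G β η →
        CenteredBoundedNoise μ f g ξ
          (fun t ω => adamIter g β β₂ η lam xinit (fun s => ξ s ω) t) σ T →
        -- the iterates run inside the domain `U` of `f` (no condition if `U` is all of `ℝᵈ`)
        (∀ᵐ ω ∂μ, ∀ t : ℕ, 1 ≤ t → t ≤ T →
          segment ℝ (adamIter g β β₂ η lam xinit (fun s => ξ s ω) t)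
            (adamIter g β β₂ η lam xinit (fun s => ξ s ω) (t + 1)) ⊆ U) →
        ENNReal.ofReal (1 - δ) ≤
          μ {ω | (∀ t : ℕ, 1 ≤ t → t ≤ T →
                ‖gradient f (adamIter g β β₂ η lam xinit (fun s => ξ s ω) t)‖ ≤ G) ∧
              1 / (T : ℝ) * ∑ t ∈ Finset.Icc 1 T,
                ‖gradient f (adamIter g β β₂ η lam xinit (fun s => ξ s ω) t)‖ ^ 2 ≤ ε ^ 2}) ∧
    -- gradient complexity: the number of iterations that some admissible choice needs
    (∀ ρ L₀ Lρ lam σ δ Δ₁ n₁ : ℝ,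
        0 ≤ ρ → ρ < 2 → 0 ≤ L₀ → 0 ≤ Lρ → 0 < lam → 0 ≤ σ → 0 < δ → δ < 1 → 0 ≤ Δ₁ → 0 ≤ n₁ →
        ∃ K : ℝ, 0 < K ∧ ∀ (d : ℕ) (ε : ℝ), 1 ≤ d → 0 < ε → ε ≤ 1 →
          ∃ G β η : ℝ,
            AdamChoice d ρ L₀ Lρ lam σ (logFactor δ) Δ₁ n₁ ε c₁ c₂ C₁ G β η ∧
            (adamHorizon Δ₁ ε C₂ G β η : ℝ) ≤
              K * (d : ℝ) ^ max (2 / (2 - ρ)) ((5 + 2 * ρ) / (4 * (2 - ρ))) / ε ^ 4) := by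
  refine ⟨7168, by norm_num, fun C₁ C₂ hC₁ hC₂ =>
    ⟨1 / (28672 * C₂), by positivity, fun c₁ c₂ hc₁0 hc₁ hc₂0 hc₂ => ?_⟩⟩
  have hc : AreAdamConstants C₁ C₂ c₁ c₂ := .of_le hC₁ hC₂ hc₁0 hc₁ hc₂0 hc₂
  constructor
  · intro d U f ρ L₀ Lρ σ Ω Ξ _ _ μ _ g ξ xinit δ ε lam G β β₂ η T hU hx hfd hfb hρ hρ2 hL₀ hLρ hf
      hσ hδ _ hε hlam hg hξ hβ₂ hch hT hnoise hseg
    subst hβ₂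
    exact adam_convergence hc ⟨hU, hfd, hfb, hρ, hρ2, hL₀, hLρ, hf⟩ hx hσ hδ hε hlam hg hξ hch hT
      hnoise hseg
  · intro ρ L₀ Lρ lam σ δ Δ₁ n₁ hρ hρ2 hL₀ hLρ hlam _ _ _ hΔ _
    exact adam_complexity hc hρ hρ2 hL₀ hLρ hlam hΔ
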